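/- **Proposition (ordinary Hilbert scales as dilational Hilbert scales).** Let $H$ be a complex Hilbert space and let $T$ be a (densely defined, possibly unbounded) self-adjoint operator on $H$ with $T\ge I$, i.e. with spectrum contained in $[1,\infty)$. For a spectral family $E$ on $H$ (an increasing, strongly right-continuous family of orthogonal projections $E(\lambda)$, $\lambda\in\mathbb R$, tending strongly to $0$ at $-\infty$ and to $I$ at $+\infty$) write $E_{f,g}(\lambda)=(E(\lambda)f,g)$, and for a measurable function $\varphi$ let $\int\varphi\,dE$ be the operator with domain $\{f\in H:\int|\varphi|^2\,dE_{f,f}<\infty\}$ that satisfies $\big((\int\varphi\,dE) f,g\big)=\int\varphi\,dE_{f,g}$. An operator $A$ has spectral family $E$ if $A=\int\lambda\,dE(\lambda)$; then $\varphi(A)=\int\varphi(\lambda)\,dE(\lambda)$. * The *ordinary Hilbert scale* defined by $T$ is the family $(H_s)_{s\ge 0}$, $H_s=D(T^{s/2})$, with scalar product $(f,g)_s=(T^{s/2}f,T^{s/2}g)$. * Let $A$ be a self-adjoint operator with spectrum in $[0,\infty)$ and spectral family $F$, and let $a:[0,\infty)\to[1,\infty)$ be increasing with $a(0)=1$. The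 *dilational Hilbert scale* generated by $a$ and $A$ is the family indexed by $s\ge 0$ of the spaces $\{f\in H:\int_0^\infty a(s\mu)\,dF_{f,f}(\mu)<\infty\}$ with scalar product $(f,g)_s=\int_0^\infty a(s\mu)\,dF_{f,g}(\mu)$. Then $T$ has exactly one spectral family $E$; the operator $\log T=\int\log\lambda\,dE(\lambda)$ is self-adjoint with spectrum contained in $[0,\infty)$, and it has exactly one spectral family. The ordinary Hilbert scale defined by $T$ is identical with the dilational Hilbert scale generated by $a(\lambda)=\exp(\lambda)$ and the operator $\log T$: for every $s\ge 0$ the two spaces with parameter $s$ are the same linear subspace of $H$ and carry the same scalar product; moreover this space is complete in the norm given by that scalar product, i.e. it is a Hilbert space. -/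

import Mathlib

open MeasureTheory Filter Set
open scoped Topology NNReal ENNReal InnerProductSpace

noncomputable section

namespace HilbertScales

variable {H : Type*} [NormedAddCommGroup H] [InnerProductSpace ℂ H] [CompleteSpace H]

/-! ### Spectral families and their Stieltjes measures -/

/-- A spectral family (resolution of the identity) on a complex Hilbert space: an increasing,
strongly right-continuous family of orthogonal projections `E(t)`, `t ∈ ℝ`, which converges
strongly to `0` at `-∞` and to the identity at `+∞`. -/
@[ext]
structure SpectralFamily (H : Type*) [NormedAddCommGroup H] [InnerProductSpace ℂ H]
    [CompleteSpace H] where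
  proj : ℝ → H →L[ℂ] H
  isStarProjection : ∀ t, IsStarProjection (proj t)
  proj_comp : ∀ s t, s ≤ t → proj s ∘L proj t = proj s
  right_continuous : ∀ f t, ContinuousWithinAt (fun u => proj u f) (Ici t) t
  tendsto_atBot : ∀ f, Tendsto (fun t => proj t f) atBot (𝓝 0)
  tendsto_atTop : ∀ f, Tendsto (fun t => proj t f) atTop (𝓝 f)

/-- The spectral family with the single jump `0 → I` at `t = 0`. -/
instance : Inhabited (SpectralFamily H) where
  default :=
    { proj := fun t => if 0 ≤ t then 1 else 0
      isStarProjection := by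
        intro t
        split_ifs
        · exact IsStarProjection.one _
        · exact IsStarProjection.zero _
      proj_comp := by
        intro s t hst
        by_cases hs : 0 ≤ s
        · simp [hs, hs.trans hst, ← ContinuousLinearMap.mul_def]
        · simp [hs]
      right_continuous := by
        intro f t
        by_cases ht : 0 ≤ t
        · refine (continuousWithinAt_const (b := f)).congr (fun u hu => ?_) ?_
          · simp [ht.trans hu]
          · simp [ht]
        · have h : (fun u : ℝ => (if 0 ≤ u then (1 : H →L[ℂ] H) else 0) f) =ᶠ[𝓝 t]
              fun _ => (0 : H) := by
            filter_upwards [Iio_mem_nhds (not_le.mp ht)] with u hu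
            simp [not_le.mpr (mem_Iio.mp hu)]
          exact (continuousAt_const.congr h.symm).continuousWithinAt
      tendsto_atBot := by
        intro f
        refine tendsto_const_nhds.congr' ?_
        filter_upwards [Iio_mem_atBot (0 : ℝ)] with u hu
        simp [not_le.mpr (mem_Iio.mp hu)]
      tendsto_atTop := by
        intro f
        refine tendsto_const_nhds.congr' ?_
        filter_upwards [Ici_mem_atTop (0 : ℝ)] with u hu
        simp [mem_Ici.mp hu] }

namespace SpectralFamily

variable (E : SpectralFamily H)

/-- The distribution function `E_{f,f}(t) = (E(t) f, f)`. -/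
def dist (f : H) (t : ℝ) : ℝ := (⟪E.proj t f, f⟫_ℂ).re

lemma inner_proj_left (t : ℝ) (f g : H) : ⟪E.proj t f, g⟫_ℂ = ⟪f, E.proj t g⟫_ℂ := by
  have h := (E.isStarProjection t).isSelfAdjoint
  rw [ContinuousLinearMap.isSelfAdjoint_iff'] at h
  conv_lhs => rw [← h]
  rw [ContinuousLinearMap.adjoint_inner_left]

lemma dist_eq_norm_sq (f : H) (t : ℝ) : E.dist f t = ‖E.proj t f‖ ^ 2 := by
  have h : E.proj t (E.proj t f) = E.proj t f := by
    have := (E.isStarProjection t).isIdempotentElem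
    exact congrArg (fun A : H →L[ℂ] H => A f) this
  rw [dist, ← h, inner_proj_left, h, inner_self_eq_norm_sq_to_K]
  norm_cast

lemma dist_mono (f : H) : Monotone (E.dist f) := by
  intro s t hst
  have h : E.proj s f = E.proj s (E.proj t f) := by
    rw [← ContinuousLinearMap.comp_apply, E.proj_comp s t hst]
  have h1 : ‖E.proj s f‖ ^ 2 ≤ ‖E.proj s f‖ * ‖E.proj t f‖ := by
    have h2 : ‖E.proj s f‖ ^ 2 = ‖⟪E.proj s f, E.proj t f⟫_ℂ‖ := by
      have h3 : ⟪E.proj s f, E.proj t f⟫_ℂ = ⟪f, E.proj s f⟫_ℂ := by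
        rw [inner_proj_left, ← h]
      have h4 : ⟪f, E.proj s f⟫_ℂ = ⟪E.proj s f, E.proj s f⟫_ℂ := by
        have h5 : E.proj s (E.proj s f) = E.proj s f :=
          congrArg (fun A : H →L[ℂ] H => A f) (E.isStarProjection s).isIdempotentElem
        rw [inner_proj_left, h5]
      rw [h3, h4, inner_self_eq_norm_sq_to_K]
      simp
    rw [h2]
    exact norm_inner_le_norm _ _
  rw [dist_eq_norm_sq, dist_eq_norm_sq]
  nlinarith [norm_nonneg (E.proj s f), norm_nonneg (E.proj t f),
    sq_nonneg (‖E.proj s f‖ - ‖E.proj t f‖)]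

/-- `t ↦ (E(t) f, f)` as a Stieltjes function. -/
def stieltjes (f : H) : StieltjesFunction ℝ where
  toFun := E.dist f
  mono' := E.dist_mono f
  right_continuous' t := by
    have h : E.dist f = fun t => ‖E.proj t f‖ ^ 2 := funext (E.dist_eq_norm_sq f)
    rw [h]
    exact (E.right_continuous f t).norm.pow 2

/-- The spectral measure `dE_{f,f}`. -/
def meas (f : H) : Measure ℝ := (E.stieltjes f).measure

lemma meas_Iic (f : H) (t : ℝ) : E.meas f (Iic t) = ENNReal.ofReal (E.dist f t) := by
  have h : Tendsto (E.stieltjes f) atBot (𝓝 0) := by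
    have h1 : (E.stieltjes f : ℝ → ℝ) = fun t => ‖E.proj t f‖ ^ 2 :=
      funext (E.dist_eq_norm_sq f)
    rw [h1]
    simpa using (E.tendsto_atBot f).norm.pow 2
  rw [meas, StieltjesFunction.measure_Iic _ h, sub_zero]
  rfl

instance (f : H) : IsFiniteMeasure (E.meas f) := by
  constructor
  have h0 : Tendsto (E.stieltjes f) atBot (𝓝 0) := by
    have h1 : (E.stieltjes f : ℝ → ℝ) = fun t => ‖E.proj t f‖ ^ 2 :=
      funext (E.dist_eq_norm_sq f)
    rw [h1]
    simpa using (E.tendsto_atBot f).norm.pow 2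
  have h : Tendsto (E.stieltjes f) atTop (𝓝 (‖f‖ ^ 2)) := by
    have h1 : (E.stieltjes f : ℝ → ℝ) = fun t => ‖E.proj t f‖ ^ 2 :=
      funext (E.dist_eq_norm_sq f)
    rw [h1]
    exact (E.tendsto_atTop f).norm.pow 2
  rw [meas, StieltjesFunction.measure_univ _ h0 h]
  exact ENNReal.ofReal_lt_top

lemma dist_nonneg (f : H) (t : ℝ) : 0 ≤ E.dist f t := by
  rw [dist_eq_norm_sq]; positivity

/-- A linear relation between the distribution functions passes to the spectral measures. -/
lemma sum_meas_eq {ι : Type} [Fintype ι] (a b : ι → ℝ≥0) (h : ι → H)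
    (h0 : ∀ t, ∑ i, (a i : ℝ) * E.dist (h i) t = ∑ i, (b i : ℝ) * E.dist (h i) t) :
    ∑ i, a i • E.meas (h i) = ∑ i, b i • E.meas (h i) := by
  have key : ∀ (c : ι → ℝ≥0) (t : ℝ), (∑ i, c i • E.meas (h i)) (Iic t) =
      ENNReal.ofReal (∑ i, (c i : ℝ) * E.dist (h i) t) := by
    intro c t
    rw [Measure.finsetSum_apply, ENNReal.ofReal_sum_of_nonneg]
    · refine Finset.sum_congr rfl fun i _ => ?_
      rw [Measure.smul_apply, meas_Iic, ENNReal.ofReal_mul (c i).coe_nonneg,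
        ENNReal.ofReal_coe_nnreal]
      rfl
    · intro i _
      exact mul_nonneg (c i).2 (E.dist_nonneg _ _)
  refine Measure.ext_of_Iic _ _ fun t => ?_
  rw [key, key, h0]

lemma sum_integral_eq_zero {ι : Type} [Fintype ι] {φ : ℝ → ℝ} (c : ι → ℝ) (h : ι → H)
    (hi : ∀ i, Integrable φ (E.meas (h i)))
    (h0 : ∀ t, ∑ i, c i * E.dist (h i) t = 0) :
    ∑ i, c i * ∫ x, φ x ∂(E.meas (h i)) = 0 := by
  have hc : ∀ i, c i = ((c i).toNNReal : ℝ) - ((-c i).toNNReal : ℝ) := fun i => by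
    rw [Real.coe_toNNReal', Real.coe_toNNReal']
    rcases le_total 0 (c i) with h | h
    · rw [max_eq_left h, max_eq_right (by linarith)]; ring
    · rw [max_eq_right h, max_eq_left (by linarith)]; ring
  have hm := E.sum_meas_eq (fun i => (c i).toNNReal) (fun i => (-c i).toNNReal) h (fun t => by
    rw [← sub_eq_zero, ← Finset.sum_sub_distrib, ← h0 t]
    refine Finset.sum_congr rfl fun i _ => ?_
    conv_rhs => rw [hc i]
    ring)
  have key : ∀ d : ι → ℝ≥0, ∫ x, φ x ∂(∑ i, d i • E.meas (h i)) =
      ∑ i, (d i : ℝ) * ∫ x, φ x ∂(E.meas (h i)) := by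
    intro d
    rw [integral_finsetSum_measure (fun i _ => (hi i).smul_measure_nnreal)]
    refine Finset.sum_congr rfl fun i _ => ?_
    rw [integral_smul_nnreal_measure]
    rfl
  have := congrArg (fun μ : Measure ℝ => ∫ x, φ x ∂μ) hm
  simp only [key] at this
  rw [← sub_eq_zero, ← Finset.sum_sub_distrib] at this
  rw [← this]
  refine Finset.sum_congr rfl fun i _ => ?_
  conv_lhs => rw [hc i]
  ring

lemma dist_add_sub (f g : H) (t : ℝ) :
    E.dist (f + g) t = E.dist f t + E.dist g t + 2 * (⟪f, E.proj t g⟫_ℂ).re := by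
  have h : (⟪E.proj t g, f⟫_ℂ).re = (⟪f, E.proj t g⟫_ℂ).re := by
    rw [← inner_conj_symm, Complex.conj_re]
  simp only [dist, map_add, inner_add_left, inner_add_right, Complex.add_re, h]
  rw [E.inner_proj_left t f g]
  ring

lemma dist_smul (c : ℂ) (f : H) (t : ℝ) : E.dist (c • f) t = ‖c‖ ^ 2 * E.dist f t := by
  simp only [dist_eq_norm_sq, map_smul, norm_smul]
  ring

lemma meas_smul (c : ℂ) (f : H) : E.meas (c • f) = (‖c‖₊ ^ 2) • E.meas f := by
  refine Measure.ext_of_Iic _ _ fun t => ?_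
  rw [Measure.smul_apply, meas_Iic, meas_Iic, dist_smul, ENNReal.ofReal_mul (by positivity),
    ENNReal.smul_def, smul_eq_mul]
  congr 1
  rw [← ENNReal.ofReal_coe_nnreal]
  simp

lemma meas_zero : E.meas 0 = 0 := by
  have := E.meas_smul 0 0
  simpa using this

lemma meas_add_le (f g : H) : E.meas (f + g) ≤ (2 : ℝ≥0) • (E.meas f + E.meas g) := by
  have h := E.sum_meas_eq (ι := Fin 4) ![1, 1, 0, 0] ![0, 0, 2, 2]
    ![f + g, f + (-1 : ℂ) • g, f, g] (fun t => by
      simp only [Fin.sum_univ_four, Matrix.cons_val]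
      rw [dist_add_sub, dist_add_sub, dist_smul]
      simp
      ring)
  simp only [Fin.sum_univ_four, Matrix.cons_val, one_smul, zero_smul, add_zero, zero_add] at h
  rw [smul_add, ← h]
  exact Measure.le_add_right le_rfl

/-! ### Integrals against the spectral family -/

/-- The integral `∫ φ dE_{g,f}` against the complex measure `dE_{g,f} = d(g, E(·) f)`, which is
conjugate linear in `g` and linear in `f`. It is obtained by polarization from the positive
measures `dE_{h,h}`. -/
def integral (φ : ℝ → ℝ) (g f : H) : ℂ :=
  (((∫ x, φ x ∂(E.meas (g + f)) : ℝ) - (∫ x, φ x ∂(E.meas (g - f)) : ℝ) : ℂ) +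
    ((∫ x, φ x ∂(E.meas (g - Complex.I • f)) : ℝ) -
      (∫ x, φ x ∂(E.meas (g + Complex.I • f)) : ℝ)) * Complex.I) / 4

/-- The space of all `f` with `∫ |φ| dE_{f,f} < ∞`. -/
def formDomain (φ : ℝ → ℝ) : Submodule ℂ H where
  carrier := {f | Integrable φ (E.meas f)}
  zero_mem' := by
    change Integrable φ (E.meas 0)
    rw [meas_zero]
    exact integrable_zero_measure
  add_mem' := fun {f g} hf hg =>
    ((hf.add_measure hg).smul_measure_nnreal).mono_measure (E.meas_add_le f g)
  smul_mem' := fun c f hf => by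
    change Integrable φ (E.meas (c • f))
    rw [meas_smul]
    exact Integrable.smul_measure_nnreal hf

/-- The space of all `f` with `∫ |φ|² dE_{f,f} < ∞`. -/
def opDomain (φ : ℝ → ℝ) : Submodule ℂ H where
  carrier := {f | MemLp φ 2 (E.meas f)}
  zero_mem' := by
    change MemLp φ 2 (E.meas 0)
    rw [meas_zero]
    exact memLp_measure_zero
  add_mem' := fun {f g} hf hg => by
    refine MemLp.mono_measure (E.meas_add_le f g) ?_
    have hm : AEStronglyMeasurable φ ((2 : ℝ≥0) • (E.meas f + E.meas g)) :=
      (hf.1.add_measure hg.1).smul_measure (2 : ℝ≥0)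
    rw [memLp_two_iff_integrable_sq hm]
    exact (((memLp_two_iff_integrable_sq hf.1).1 hf).add_measure
      ((memLp_two_iff_integrable_sq hg.1).1 hg)).smul_measure_nnreal
  smul_mem' := fun c f hf => by
    change MemLp φ 2 (E.meas (c • f))
    rw [meas_smul]
    exact MemLp.smul_measure hf ENNReal.coe_ne_top

lemma opDomain_le_formDomain (φ : ℝ → ℝ) : E.opDomain φ ≤ E.formDomain φ := fun f hf => by
  have : MemLp φ 2 (E.meas f) := hf
  exact this.integrable (by norm_num)

variable {E} {φ : ℝ → ℝ}

lemma integral_re (g f : H) : (E.integral φ g f).re =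
    ((∫ x, φ x ∂(E.meas (g + f))) - ∫ x, φ x ∂(E.meas (g - f))) / 4 := by
  simp [integral]

lemma integral_im (g f : H) : (E.integral φ g f).im =
    ((∫ x, φ x ∂(E.meas (g - Complex.I • f))) - ∫ x, φ x ∂(E.meas (g + Complex.I • f))) / 4 := by
  simp [integral]

lemma integral_im_eq (g f : H) :
    (E.integral φ g f).im = - (E.integral φ g (Complex.I • f)).re := by
  rw [integral_re, integral_im]; ring

lemma integral_re_add {g f₁ f₂ : H} (hg : g ∈ E.formDomain φ) (h₁ : f₁ ∈ E.formDomain φ)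
    (h₂ : f₂ ∈ E.formDomain φ) : (E.integral φ g (f₁ + f₂)).re =
      (E.integral φ g f₁).re + (E.integral φ g f₂).re := by
  have key := E.sum_integral_eq_zero (φ := φ) (ι := Fin 6) ![1, -1, -1, 1, -1, 1]
    ![g + (f₁ + f₂), g + (-1 : ℂ) • (f₁ + f₂), g + f₁, g + (-1 : ℂ) • f₁, g + f₂,
      g + (-1 : ℂ) • f₂] (fun i => by
        change _ ∈ E.formDomain φ
        fin_cases i
        · exact add_mem hg (add_mem h₁ h₂)
        · exact add_mem hg (Submodule.smul_mem _ _ (add_mem h₁ h₂))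
        · exact add_mem hg h₁
        · exact add_mem hg (Submodule.smul_mem _ _ h₁)
        · exact add_mem hg h₂
        · exact add_mem hg (Submodule.smul_mem _ _ h₂)) (fun t => by
      simp only [Fin.sum_univ_six, Matrix.cons_val]
      simp only [dist_add_sub E g, dist_smul, map_add, map_smul, inner_add_right, inner_smul_right,
        Complex.add_re]
      simp
      ring)
  simp only [Fin.sum_univ_six, Matrix.cons_val, neg_one_smul, ← sub_eq_add_neg] at key
  simp only [integral_re]
  linarith

lemma integral_re_smul {g f : H} (c : ℝ) (hg : g ∈ E.formDomain φ) (hf : f ∈ E.formDomain φ) :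
    (E.integral φ g ((c : ℂ) • f)).re = c * (E.integral φ g f).re := by
  have key := E.sum_integral_eq_zero (φ := φ) (ι := Fin 4) ![1, -1, -c, c]
    ![g + (c : ℂ) • f, g + (-1 : ℂ) • ((c : ℂ) • f), g + f, g + (-1 : ℂ) • f] (fun i => by
        change _ ∈ E.formDomain φ
        fin_cases i
        · exact add_mem hg (Submodule.smul_mem _ _ hf)
        · exact add_mem hg (Submodule.smul_mem _ _ (Submodule.smul_mem _ _ hf))
        · exact add_mem hg hf
        · exact add_mem hg (Submodule.smul_mem _ _ hf)) (fun t => by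
      simp only [Fin.sum_univ_four, Matrix.cons_val]
      simp only [dist_add_sub E g, dist_smul, map_smul, inner_smul_right]
      simp
      ring)
  simp only [Fin.sum_univ_four, Matrix.cons_val, neg_one_smul, ← sub_eq_add_neg] at key
  simp only [integral_re]
  linarith

lemma integral_add_right {g f₁ f₂ : H} (hg : g ∈ E.formDomain φ) (h₁ : f₁ ∈ E.formDomain φ)
    (h₂ : f₂ ∈ E.formDomain φ) :
    E.integral φ g (f₁ + f₂) = E.integral φ g f₁ + E.integral φ g f₂ := by
  apply Complex.ext
  · rw [Complex.add_re, integral_re_add hg h₁ h₂]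
  · rw [Complex.add_im, integral_im_eq, integral_im_eq, integral_im_eq, smul_add,
      integral_re_add hg (Submodule.smul_mem _ _ h₁) (Submodule.smul_mem _ _ h₂)]
    ring

lemma integral_smul_right {g f : H} (c : ℂ) (hg : g ∈ E.formDomain φ)
    (hf : f ∈ E.formDomain φ) : E.integral φ g (c • f) = c * E.integral φ g f := by
  have hI : Complex.I • f ∈ E.formDomain φ := Submodule.smul_mem _ _ hf
  have hc : c • f = (c.re : ℂ) • f + (c.im : ℂ) • (Complex.I • f) := by
    rw [smul_smul, ← add_smul, Complex.re_add_im]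
  have hc' : Complex.I • (c • f) = (c.re : ℂ) • (Complex.I • f) + ((-c.im : ℝ) : ℂ) • f := by
    rw [hc, smul_add, smul_smul, smul_smul, smul_smul, smul_smul, mul_comm Complex.I,
      mul_comm Complex.I, mul_assoc, Complex.I_mul_I, mul_neg_one, Complex.ofReal_neg]
  apply Complex.ext
  · rw [Complex.mul_re, integral_im_eq, hc, integral_re_add hg (Submodule.smul_mem _ _ hf)
      (Submodule.smul_mem _ _ hI), integral_re_smul _ hg hf, integral_re_smul _ hg hI]
    ring
  · rw [Complex.mul_im, integral_im_eq, integral_im_eq, hc',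
      integral_re_add hg (Submodule.smul_mem _ _ hI) (Submodule.smul_mem _ _ hf),
      integral_re_smul _ hg hI, integral_re_smul _ hg hf]
    ring

lemma integral_conj_symm (g f : H) : (starRingEnd ℂ) (E.integral φ f g) = E.integral φ g f := by
  have hn : ∀ h : H, E.meas (-h) = E.meas h := fun h => by
    have := E.meas_smul (-1) h
    simpa using this
  have hI : ∀ h : H, E.meas (Complex.I • h) = E.meas h := fun h => by
    have := E.meas_smul Complex.I h
    simpa using this
  have e1 : E.meas (f - g) = E.meas (g - f) := by rw [← hn, neg_sub]
  have e2 : E.meas (f - Complex.I • g) = E.meas (g + Complex.I • f) := by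
    rw [← hI (f - Complex.I • g)]
    congr 1
    rw [smul_sub, smul_smul, Complex.I_mul_I]
    simp [add_comm]
  have e3 : E.meas (f + Complex.I • g) = E.meas (g - Complex.I • f) := by
    rw [← hI (f + Complex.I • g), ← hn]
    congr 1
    rw [smul_add, smul_smul, Complex.I_mul_I]
    simp [sub_eq_add_neg]
  apply Complex.ext
  · rw [Complex.conj_re, integral_re, integral_re, add_comm f g, e1]
  · rw [Complex.conj_im, integral_im, integral_im, e2, e3]
    ring

variable (E) (φ)

/-- The sesquilinear form `(g, f)_φ = ∫ φ dE_{g,f}` on its natural domain. -/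
def form : E.formDomain φ →ₗ⋆[ℂ] E.formDomain φ →ₗ[ℂ] ℂ :=
  LinearMap.mk₂'ₛₗ (starRingEnd ℂ) (RingHom.id ℂ) (fun g f => E.integral φ (g : H) (f : H))
    (fun g₁ g₂ f => by
      rw [← integral_conj_symm, ← integral_conj_symm (g₁ : H), ← integral_conj_symm (g₂ : H),
        Submodule.coe_add, integral_add_right f.2 g₁.2 g₂.2, map_add])
    (fun c g f => by
      rw [← integral_conj_symm, ← integral_conj_symm (g : H), Submodule.coe_smul,
        integral_smul_right c f.2 g.2, map_mul, smul_eq_mul])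
    (fun g f₁ f₂ => by rw [Submodule.coe_add, integral_add_right g.2 f₁.2 f₂.2])
    (fun c g f => by
      rw [Submodule.coe_smul, integral_smul_right c g.2 f.2, RingHom.id_apply, smul_eq_mul])

/-- The operator `∫ φ dE`. Its graph consists of all pairs `(f, v)` such that
`∫ |φ|² dE_{f,f} < ∞` and `(g, v) = ∫ φ dE_{g,f}` for all `g` in the (dense) domain
`{g | ∫ |φ|² dE_{g,g} < ∞}`. -/
def op : H →ₗ.[ℂ] H :=
  Submodule.toLinearPMap
    { carrier := {p : H × H | p.1 ∈ E.opDomain φ ∧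
        ∀ g ∈ E.opDomain φ, ⟪g, p.2⟫_ℂ = E.integral φ g p.1}
      zero_mem' := by
        refine ⟨zero_mem _, fun g hg => ?_⟩
        have := integral_smul_right 0 (E.opDomain_le_formDomain φ hg)
          (zero_mem (E.formDomain φ))
        simpa using this.symm
      add_mem' := fun {p q} hp hq => by
        refine ⟨add_mem hp.1 hq.1, fun g hg => ?_⟩
        rw [Prod.snd_add, Prod.fst_add, inner_add_right, hp.2 g hg, hq.2 g hg,
          integral_add_right (E.opDomain_le_formDomain φ hg) (E.opDomain_le_formDomain φ hp.1)
            (E.opDomain_le_formDomain φ hq.1)]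
      smul_mem' := fun c p hp => by
        refine ⟨Submodule.smul_mem _ _ hp.1, fun g hg => ?_⟩
        rw [Prod.smul_snd, Prod.smul_fst, inner_smul_right, hp.2 g hg,
          integral_smul_right c (E.opDomain_le_formDomain φ hg)
            (E.opDomain_le_formDomain φ hp.1)] }

/-- `E` is a spectral family of the operator `T`, that is, `T = ∫ t dE(t)`. -/
def IsSpectralFamilyOf (T : H →ₗ.[ℂ] H) : Prop := E.op (fun t => t) = T

end SpectralFamily

/-! ### Functions of a self-adjoint operator -/

/-- The spectrum of an unbounded operator: the set of those `z` for which `T - z` has no bounded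
everywhere defined inverse. -/
def opSpectrum (T : H →ₗ.[ℂ] H) : Set ℂ :=
  {z | ¬ ∃ R : H →L[ℂ] H, (∀ f : H, ∃ h : R f ∈ T.domain, T ⟨R f, h⟩ - z • R f = f) ∧
    ∀ f : T.domain, R (T f - z • (f : H)) = f}

open Classical in
/-- The spectral family of a self-adjoint operator `T`. -/
def spectralFamily (T : H →ₗ.[ℂ] H) : SpectralFamily H :=
  if h : ∃ E : SpectralFamily H, E.IsSpectralFamilyOf T then h.choose else default

/-- `φ(T) = ∫ φ(t) dE(t)`, where `E` is the spectral family of `T`. -/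
def functionOf (φ : ℝ → ℝ) (T : H →ₗ.[ℂ] H) : H →ₗ.[ℂ] H := (spectralFamily T).op φ

/-- The logarithm `log T = ∫ log t dE(t)` (for `T ≥ I`). -/
def opLog (T : H →ₗ.[ℂ] H) : H →ₗ.[ℂ] H := functionOf Real.log T

/-- The power `T ^ r = ∫ t ^ r dE(t)` (for `T ≥ I`). -/
def opPow (T : H →ₗ.[ℂ] H) (r : ℝ) : H →ₗ.[ℂ] H := functionOf (fun t => t ^ r) T

/-! ### Scales of spaces -/

/-- A linear subspace of `H` with a sesquilinear form on it. -/
structure FormSubspace (H : Type*) [NormedAddCommGroup H] [InnerProductSpace ℂ H] where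
  space : Submodule ℂ H
  form : space →ₗ⋆[ℂ] space →ₗ[ℂ] ℂ

/-- The form is a scalar product, and the space is complete in the norm that it defines. -/
structure FormSubspace.IsHilbert (X : FormSubspace H) : Prop where
  conj_symm : ∀ f g, (starRingEnd ℂ) (X.form g f) = X.form f g
  pos : ∀ f, f ≠ 0 → 0 < (X.form f f).re
  complete : ∀ u : ℕ → X.space,
    (∀ ε > 0, ∃ N, ∀ m ≥ N, ∀ n ≥ N, (X.form (u m - u n) (u m - u n)).re < ε) →
    ∃ f : X.space, Tendsto (fun n => (X.form (u n - f) (u n - f)).re) atTop (𝓝 0)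

/-- The space `H_φ = {f | ∫ φ dE_{f,f} < ∞}` with `(g, f)_φ = ∫ φ dE_{g,f}`, where `E` is the
spectral family of `A` and `φ` is an index function. -/
def variableSpace (φ : ℝ → ℝ) (A : H →ₗ.[ℂ] H) : FormSubspace H where
  space := (spectralFamily A).formDomain φ
  form := (spectralFamily A).form φ

/-- The dilational Hilbert scale generated by `a` and `A`: at the parameter `s` it is the space of
the index function `t ↦ a (s t)`, with squared norm `∫ a (s t) dE_{f,f}(t)`. Only the values of
`a` on `[0, ∞)` matter when `A ≥ 0`. -/
def dilationalHilbertScale (a : ℝ → ℝ) (A : H →ₗ.[ℂ] H) (s : ℝ≥0) : FormSubspace H :=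
  variableSpace (fun t => a (s * t)) A

/-- The ordinary Hilbert scale generated by `T`: at the parameter `s` it is the domain of
`T ^ (s / 2)` with the scalar product `(T ^ (s / 2) g, T ^ (s / 2) f)`. -/
def ordinaryHilbertScale (T : H →ₗ.[ℂ] H) (s : ℝ≥0) : FormSubspace H where
  space := (opPow T (s / 2)).domain
  form := LinearMap.mk₂'ₛₗ (starRingEnd ℂ) (RingHom.id ℂ)
    (fun g f => ⟪opPow T (s / 2) g, opPow T (s / 2) f⟫_ℂ)
    (fun g₁ g₂ f => by rw [LinearPMap.map_add, inner_add_left])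
    (fun c g f => by rw [LinearPMap.map_smul, inner_smul_left, smul_eq_mul])
    (fun g f₁ f₂ => by rw [LinearPMap.map_add, inner_add_right])
    (fun c g f => by rw [LinearPMap.map_smul, inner_smul_right, RingHom.id_apply, smul_eq_mul])

end HilbertScales

end

noncomputable section

namespace HilbertScales

variable {H : Type*} [NormedAddCommGroup H] [InnerProductSpace ℂ H] [CompleteSpace H]

/-! ### Bounded measurable functions -/

/-! Since the spectrum of `T` lies in `[1, ∞)`, `R = T⁻¹` is bounded and self-adjoint, with spectrum
in `[0, 1]` and trivial kernel. Its continuous functional calculus yields a spectral family: `E(t)`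
projects onto the kernel of `(1 - tR)⁺`, the part of the spectrum where `1/x ≤ t`. The operator `∫ t
dE` has inverse `R`, hence equals `T` (`exists_isSpectralFamilyOf`). The family is unique because
the resolvent of `∫ t dE` at `i` determines the integrals of `1/(1 + t²)` and `t/(1 + t²)`, which
separate points and so determine every `dE_{f,f}` (`eq_of_op_eq`).

The measures `dE_{f,f}` live on `[1, ∞)`, so `F(t) = E(exp t)` is again a spectral family,
`dF_{f,f}` is the image of `dE_{f,f}` under `log`, and `F` belongs to `log T`. The equality of the
scales is then a change of variables: `‖T^{s/2} f‖² = ∫ λ^s dE_{f,f} = ∫ exp(s log λ) dE_{f,f} = ∫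
exp(sμ) dF_{f,f}`, polarized in `inner_op_op`. Completeness holds because `T^{s/2}` has a bounded
inverse.

All this rests on a functional calculus for a spectral family: bounded functions enter through
polarized integrals (multiplicativity is `bounded_inner_bounded`), unbounded ones through truncation
(`exists_tendsto_truncation`), and `isResolvent_op` gives explicit resolvents, hence
self-adjointness and spectral bounds. -/

/-- Bounded Borel functions on the real line. -/
structure IsBoundedMeasurable (φ : ℝ → ℝ) : Prop where
  measurable : Measurable φ
  bounded : ∃ C, ∀ x, |φ x| ≤ C

namespace IsBoundedMeasurable

variable {φ ψ : ℝ → ℝ}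

lemma const (c : ℝ) : IsBoundedMeasurable fun _ => c :=
  ⟨measurable_const, |c|, fun _ => le_rfl⟩

lemma add (hφ : IsBoundedMeasurable φ) (hψ : IsBoundedMeasurable ψ) :
    IsBoundedMeasurable fun x => φ x + ψ x := by
  obtain ⟨C, hC⟩ := hφ.bounded
  obtain ⟨D, hD⟩ := hψ.bounded
  exact ⟨hφ.measurable.add hψ.measurable, C + D,
    fun x => (abs_add_le _ _).trans (add_le_add (hC x) (hD x))⟩

lemma mul (hφ : IsBoundedMeasurable φ) (hψ : IsBoundedMeasurable ψ) :
    IsBoundedMeasurable fun x => φ x * ψ x := by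
  obtain ⟨C, hC⟩ := hφ.bounded
  obtain ⟨D, hD⟩ := hψ.bounded
  refine ⟨hφ.measurable.mul hψ.measurable, C * D, fun x => ?_⟩
  rw [abs_mul]
  exact mul_le_mul (hC x) (hD x) (abs_nonneg _) ((abs_nonneg _).trans (hC x))

lemma const_mul (c : ℝ) (hφ : IsBoundedMeasurable φ) : IsBoundedMeasurable fun x => c * φ x :=
  (const c).mul hφ

lemma indicator (hφ : IsBoundedMeasurable φ) {S : Set ℝ} (hS : MeasurableSet S) :
    IsBoundedMeasurable (S.indicator φ) := by
  obtain ⟨C, hC⟩ := hφ.bounded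
  refine ⟨hφ.measurable.indicator hS, C, fun x => ?_⟩
  by_cases hx : x ∈ S
  · rw [indicator_of_mem hx]; exact hC x
  · rw [indicator_of_notMem hx, abs_zero]; exact (abs_nonneg _).trans (hC x)

lemma integrable (hφ : IsBoundedMeasurable φ) (μ : Measure ℝ) [IsFiniteMeasure μ] :
    Integrable φ μ := by
  obtain ⟨C, hC⟩ := hφ.bounded
  exact Integrable.of_bound hφ.measurable.aestronglyMeasurable C (ae_of_all _ hC)

end IsBoundedMeasurable

/-- If the signed measures `μ₁ - μ₂` and `φ (ν₁ - ν₂)` have the same distribution function, then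
they have the same integrals. -/
lemma integral_sub_integral_eq_of_Iic {μ₁ μ₂ ν₁ ν₂ : Measure ℝ} [IsFiniteMeasure μ₁]
    [IsFiniteMeasure μ₂] [IsFiniteMeasure ν₁] [IsFiniteMeasure ν₂] {φ ψ : ℝ → ℝ}
    (hφ : IsBoundedMeasurable φ) (hψ : IsBoundedMeasurable ψ)
    (h : ∀ t, μ₁.real (Iic t) - μ₂.real (Iic t) =
      (∫ x in Iic t, φ x ∂ν₁) - ∫ x in Iic t, φ x ∂ν₂) :
    (∫ x, ψ x ∂μ₁) - ∫ x, ψ x ∂μ₂ = (∫ x, φ x * ψ x ∂ν₁) - ∫ x, φ x * ψ x ∂ν₂ := by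
  set p : ℝ → ℝ≥0 := fun x => (φ x).toNNReal with hp
  set q : ℝ → ℝ≥0 := fun x => (-φ x).toNNReal with hq
  have hpm : Measurable p := hφ.measurable.real_toNNReal
  have hqm : Measurable q := hφ.measurable.neg.real_toNNReal
  have hpq : ∀ x, φ x = (p x : ℝ) - (q x : ℝ) := fun x => by
    rw [hp, hq]
    simp only [Real.coe_toNNReal']
    rcases le_total 0 (φ x) with h | h
    · rw [max_eq_left h, max_eq_right (by linarith)]; ring
    · rw [max_eq_right h, max_eq_left (by linarith)]; ring
  obtain ⟨C, hC⟩ := hφ.bounded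
  have hpC : ∀ x, (p x : ℝ) ≤ |C| := fun x => by
    rw [hp]; simp only [Real.coe_toNNReal']
    exact max_le ((le_abs_self _).trans ((hC x).trans (le_abs_self _))) (abs_nonneg _)
  have hqC : ∀ x, (q x : ℝ) ≤ |C| := fun x => by
    rw [hq]; simp only [Real.coe_toNNReal']
    exact max_le ((neg_le_abs _).trans ((hC x).trans (le_abs_self _))) (abs_nonneg _)
  have hpb : IsBoundedMeasurable fun x => (p x : ℝ) :=
    ⟨hpm.coe_nnreal_real, |C|, fun x => by rw [abs_of_nonneg (p x).coe_nonneg]; exact hpC x⟩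
  have hqb : IsBoundedMeasurable fun x => (q x : ℝ) :=
    ⟨hqm.coe_nnreal_real, |C|, fun x => by rw [abs_of_nonneg (q x).coe_nonneg]; exact hqC x⟩
  have fin : ∀ (ν : Measure ℝ) [IsFiniteMeasure ν] (r : ℝ → ℝ≥0),
      IsBoundedMeasurable (fun x => (r x : ℝ)) → IsFiniteMeasure (ν.withDensity fun x => r x) := by
    intro ν _ r hr
    refine isFiniteMeasure_withDensity ?_
    have := (hr.integrable ν).2
    rw [hasFiniteIntegral_iff_norm] at this
    refine ne_of_lt (lt_of_eq_of_lt ?_ this)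
    refine lintegral_congr fun x => ?_
    rw [Real.norm_of_nonneg (r x).coe_nonneg]; simp
  have : IsFiniteMeasure (ν₁.withDensity fun x => p x) := fin ν₁ p hpb
  have : IsFiniteMeasure (ν₁.withDensity fun x => q x) := fin ν₁ q hqb
  have : IsFiniteMeasure (ν₂.withDensity fun x => p x) := fin ν₂ p hpb
  have : IsFiniteMeasure (ν₂.withDensity fun x => q x) := fin ν₂ q hqb
  have hreal : ∀ (ν : Measure ℝ) [IsFiniteMeasure ν] (r : ℝ → ℝ≥0),
      IsBoundedMeasurable (fun x => (r x : ℝ)) → ∀ t,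
      (ν.withDensity fun x => r x).real (Iic t) = ∫ x in Iic t, (r x : ℝ) ∂ν := by
    intro ν _ r hr t
    rw [measureReal_def, withDensity_apply _ measurableSet_Iic,
      integral_eq_lintegral_of_nonneg_ae (ae_of_all _ fun x => (r x).coe_nonneg)
        hr.measurable.aestronglyMeasurable]
    congr 2
    exact funext fun x => by simp
  -- With the negative parts moved across, both sides are finite positive measures, and these are
  -- determined by their values on half-lines.
  have key : μ₁ + (ν₁.withDensity fun x => q x) + (ν₂.withDensity fun x => p x) =
      μ₂ + (ν₁.withDensity fun x => p x) + (ν₂.withDensity fun x => q x) := by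
    refine Measure.ext_of_Iic _ _ fun t => ?_
    rw [← measureReal_eq_measureReal_iff]
    have ht := h t
    simp only [hpq] at ht
    rw [integral_sub (hpb.integrable _) (hqb.integrable _),
      integral_sub (hpb.integrable _) (hqb.integrable _)] at ht
    rw [measureReal_add_apply, measureReal_add_apply, measureReal_add_apply,
      measureReal_add_apply, hreal ν₁ q hqb, hreal ν₁ p hpb, hreal ν₂ q hqb, hreal ν₂ p hpb]
    linarith
  have hint := congrArg (fun μ : Measure ℝ => ∫ x, ψ x ∂μ) key
  rw [integral_add_measure (hψ.integrable _) (hψ.integrable _),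
    integral_add_measure (hψ.integrable _) (hψ.integrable _),
    integral_add_measure (hψ.integrable _) (hψ.integrable _),
    integral_add_measure (hψ.integrable _) (hψ.integrable _),
    integral_withDensity_eq_integral_smul hqm, integral_withDensity_eq_integral_smul hpm,
    integral_withDensity_eq_integral_smul hqm, integral_withDensity_eq_integral_smul hpm] at hint
  simp only [NNReal.smul_def, smul_eq_mul] at hint
  simp only [hpq, sub_mul]
  rw [integral_sub ((hpb.mul hψ).integrable _) ((hqb.mul hψ).integrable _),
    integral_sub ((hpb.mul hψ).integrable _) ((hqb.mul hψ).integrable _)]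
  linarith

namespace SpectralFamily

variable (E : SpectralFamily H) {φ ψ : ℝ → ℝ}

/-! ### Further properties of the spectral measures -/

lemma proj_apply_of_le {s t : ℝ} (h : s ≤ t) (f : H) : E.proj s (E.proj t f) = E.proj s f := by
  rw [← ContinuousLinearMap.comp_apply, E.proj_comp s t h]

lemma proj_apply_of_ge {s t : ℝ} (h : s ≤ t) (f : H) : E.proj t (E.proj s f) = E.proj s f := by
  refine ext_inner_right ℂ fun g => ?_
  rw [inner_proj_left, inner_proj_left, proj_apply_of_le E h, inner_proj_left]

lemma proj_comm (s t : ℝ) (f : H) : E.proj s (E.proj t f) = E.proj t (E.proj s f) := by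
  rcases le_total s t with h | h
  · rw [proj_apply_of_le E h, proj_apply_of_ge E h]
  · rw [proj_apply_of_le E h, proj_apply_of_ge E h]

lemma dist_tendsto_atTop (f : H) : Tendsto (E.dist f) atTop (𝓝 (‖f‖ ^ 2)) := by
  rw [show E.dist f = fun t => ‖E.proj t f‖ ^ 2 from funext (E.dist_eq_norm_sq f)]
  exact (E.tendsto_atTop f).norm.pow 2

lemma meas_real_univ (f : H) : (E.meas f).real univ = ‖f‖ ^ 2 := by
  have h0 : Tendsto (E.stieltjes f) atBot (𝓝 0) := by
    have h1 : (E.stieltjes f : ℝ → ℝ) = fun t => ‖E.proj t f‖ ^ 2 :=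
      funext (E.dist_eq_norm_sq f)
    rw [h1]
    simpa using (E.tendsto_atBot f).norm.pow 2
  rw [measureReal_def, meas, StieltjesFunction.measure_univ _ h0 (E.dist_tendsto_atTop f),
    sub_zero, ENNReal.toReal_ofReal (by positivity)]

lemma meas_real_Iic (f : H) (t : ℝ) : (E.meas f).real (Iic t) = E.dist f t := by
  rw [measureReal_def, meas_Iic, ENNReal.toReal_ofReal (E.dist_nonneg f t)]

lemma meas_proj (f : H) (t : ℝ) : E.meas (E.proj t f) = (E.meas f).restrict (Iic t) := by
  refine Measure.ext_of_Iic _ _ fun s => ?_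
  rw [Measure.restrict_apply measurableSet_Iic, Iic_inter_Iic, meas_Iic, meas_Iic,
    dist_eq_norm_sq, dist_eq_norm_sq]
  rcases le_total s t with h | h
  · rw [proj_apply_of_le E h, inf_eq_left.2 h]
  · rw [proj_apply_of_ge E h, inf_eq_right.2 h]

/-- Equality of spectral families is equality of the spectral measures. -/
lemma ext_of_meas {E F : SpectralFamily H} (h : ∀ f, E.meas f = F.meas f) : E = F := by
  refine SpectralFamily.ext (funext fun t => ?_)
  refine ContinuousLinearMap.ext fun f => ?_
  have hd : ∀ f, E.dist f t = F.dist f t := fun f => by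
    rw [← meas_real_Iic, ← meas_real_Iic, h]
  -- Polarization: the quadratic forms give the real part of the sesquilinear form, and replacing
  -- `f` by `i f` gives the imaginary part.
  have hre : ∀ f g : H, (⟪f, E.proj t g⟫_ℂ).re = (⟪f, F.proj t g⟫_ℂ).re := fun f g => by
    have h1 := E.dist_add_sub f g t
    have h2 := F.dist_add_sub f g t
    rw [hd, hd, hd] at h1
    linarith
  refine ext_inner_left ℂ fun g => ?_
  apply Complex.ext
  · exact hre g f
  · have := hre g (Complex.I • f)
    simpa [inner_smul_right] using this

/-- The hypothesis ranges over all vectors because polarization involves the measures of `g ± f` and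
`g ± i f`. -/
lemma integral_congr {g f : H} (h : ∀ f, φ =ᵐ[E.meas f] ψ) :
    E.integral φ g f = E.integral ψ g f := by
  simp only [integral]
  rw [integral_congr_ae (h (g + f)), integral_congr_ae (h (g - f)),
    integral_congr_ae (h (g - Complex.I • f)), integral_congr_ae (h (g + Complex.I • f))]

/-- The imaginary part cancels because `i (f - i f) = f + i f`, and a unimodular factor does not
change the spectral measure. -/
lemma integral_self (f : H) :
    E.integral φ f f = ((∫ x, φ x ∂(E.meas f) : ℝ) : ℂ) := by
  have h2 : E.meas (f + f) = (4 : ℝ≥0) • E.meas f := by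
    have := E.meas_smul 2 f
    rw [two_smul] at this
    rw [this]; congr 1
    ext; norm_num
  apply Complex.ext
  · rw [integral_re, h2, sub_self, meas_zero, integral_zero_measure,
      integral_smul_nnreal_measure, Complex.ofReal_re, NNReal.smul_def]
    simp
  · rw [integral_im, Complex.ofReal_im]
    have : E.meas (f - Complex.I • f) = E.meas (f + Complex.I • f) := by
      have h1 := E.meas_smul Complex.I (f - Complex.I • f)
      rw [smul_sub, smul_smul, Complex.I_mul_I] at h1
      rw [Complex.nnnorm_I, one_pow, one_smul] at h1
      rw [← h1]; congr 1; simp [add_comm]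
    rw [this]; simp

end SpectralFamily

namespace SpectralFamily

variable (E : SpectralFamily H) {φ ψ : ℝ → ℝ}

/-! ### Bounded functions of a spectral family -/

lemma mem_formDomain_of_isBoundedMeasurable (hφ : IsBoundedMeasurable φ) (f : H) :
    f ∈ E.formDomain φ := hφ.integrable (E.meas f)

lemma abs_integral_meas_le {C : ℝ} (hC : ∀ x, |φ x| ≤ C) (f : H) :
    |∫ x, φ x ∂(E.meas f)| ≤ C * ‖f‖ ^ 2 := by
  have := norm_integral_le_of_norm_le_const (μ := E.meas f) (f := φ) (C := C) (ae_of_all _ hC)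
  rwa [meas_real_univ] at this

lemma norm_integral_le_add {C : ℝ} (hC : ∀ x, |φ x| ≤ C) (g f : H) :
    ‖E.integral φ g f‖ ≤ C * (‖g‖ ^ 2 + ‖f‖ ^ 2) := by
  have hre : ∀ f, |(E.integral φ g f).re| ≤ C * (‖g‖ ^ 2 + ‖f‖ ^ 2) / 2 := fun f => by
    have h1 := abs_le.1 (E.abs_integral_meas_le hC (g + f))
    have h2 := abs_le.1 (E.abs_integral_meas_le hC (g - f))
    have h3 := parallelogram_law_with_norm ℂ g f
    have h4 : C * (‖g‖ ^ 2 + ‖f‖ ^ 2) = (C * ‖g + f‖ ^ 2 + C * ‖g - f‖ ^ 2) / 2 := by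
      linear_combination (-C / 2) * h3
    rw [integral_re, abs_le, h4]
    constructor <;> linarith
  have him : |(E.integral φ g f).im| ≤ C * (‖g‖ ^ 2 + ‖f‖ ^ 2) / 2 := by
    rw [integral_im_eq, abs_neg]
    simpa [norm_smul] using hre (Complex.I • f)
  refine (Complex.norm_le_abs_re_add_abs_im _).trans ?_
  linarith [hre f]

/-- Rescaling to unit vectors turns the additive bound of `norm_integral_le_add` into a
multiplicative one. The constant need not be sharp: only continuity of the form matters. -/
lemma norm_integral_le {C : ℝ} (hφ : Measurable φ) (hC : ∀ x, |φ x| ≤ C) (g f : H) :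
    ‖E.integral φ g f‖ ≤ 2 * C * ‖g‖ * ‖f‖ := by
  have hb : IsBoundedMeasurable φ := ⟨hφ, C, hC⟩
  have hm := E.mem_formDomain_of_isBoundedMeasurable hb
  have hz : ∀ g, E.integral φ g 0 = 0 := fun g => by
    have := integral_smul_right (E := E) 0 (hm g) (hm 0)
    simpa using this
  by_cases hf : f = 0
  · simp [hf, hz]
  by_cases hg : g = 0
  · rw [hg, ← integral_conj_symm, hz]; simp
  have hf' : 0 < ‖f‖ := norm_pos_iff.2 hf
  have hg' : 0 < ‖g‖ := norm_pos_iff.2 hg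
  have h1 := E.norm_integral_le_add hC (((‖g‖⁻¹ : ℝ) : ℂ) • g) (((‖f‖⁻¹ : ℝ) : ℂ) • f)
  rw [integral_smul_right _ (hm _) (hm _), ← integral_conj_symm,
    integral_smul_right _ (hm _) (hm _), norm_smul, norm_smul, norm_mul, RCLike.norm_conj,
    norm_mul, ← RCLike.norm_conj (E.integral φ f g), integral_conj_symm] at h1
  simp only [Complex.norm_real, norm_inv, norm_norm] at h1
  rw [inv_mul_cancel₀ hf'.ne', inv_mul_cancel₀ hg'.ne', ← mul_assoc, ← mul_inv,
    inv_mul_le_iff₀ (by positivity)] at h1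
  nlinarith

/-- A bounded sesquilinear form is represented by a bounded operator (Fréchet–Riesz). -/
lemma exists_clm_inner_eq_integral (hφ : IsBoundedMeasurable φ) :
    ∃ B : H →L[ℂ] H, ∀ g f, ⟪g, B f⟫_ℂ = E.integral φ g f := by
  obtain ⟨C, hC⟩ := hφ.bounded
  have hm := E.mem_formDomain_of_isBoundedMeasurable hφ
  let B₀ : H →ₗ⋆[ℂ] H →ₗ[ℂ] ℂ :=
    LinearMap.mk₂'ₛₗ (starRingEnd ℂ) (RingHom.id ℂ) (fun g f => E.integral φ g f)
      (fun g₁ g₂ f => by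
        rw [← integral_conj_symm, ← integral_conj_symm g₁, ← integral_conj_symm g₂,
          integral_add_right (hm _) (hm _) (hm _), map_add])
      (fun c g f => by
        rw [← integral_conj_symm, ← integral_conj_symm g,
          integral_smul_right c (hm _) (hm _), map_mul, smul_eq_mul])
      (fun g f₁ f₂ => integral_add_right (hm _) (hm _) (hm _))
      (fun c g f => by
        rw [integral_smul_right c (hm _) (hm _), RingHom.id_apply, smul_eq_mul])
  let B₁ : H →L⋆[ℂ] H →L[ℂ] ℂ :=
    B₀.mkContinuous₂ (2 * C) fun g f => E.norm_integral_le hφ.measurable hC g f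
  refine ⟨ContinuousLinearMap.adjoint (InnerProductSpace.continuousLinearMapOfBilin B₁),
    fun g f => ?_⟩
  rw [ContinuousLinearMap.adjoint_inner_right,
    InnerProductSpace.continuousLinearMapOfBilin_apply]
  rfl

open Classical in
/-- The bounded operator `∫ φ dE` for a bounded Borel function `φ`. -/
def bounded (φ : ℝ → ℝ) : H →L[ℂ] H :=
  if h : IsBoundedMeasurable φ then (E.exists_clm_inner_eq_integral h).choose else 0

lemma inner_bounded (hφ : IsBoundedMeasurable φ) (g f : H) :
    ⟪g, E.bounded φ f⟫_ℂ = E.integral φ g f := by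
  rw [bounded, dif_pos hφ]
  exact (E.exists_clm_inner_eq_integral hφ).choose_spec g f

lemma bounded_inner (hφ : IsBoundedMeasurable φ) (g f : H) :
    ⟪E.bounded φ g, f⟫_ℂ = E.integral φ g f := by
  rw [← inner_conj_symm, inner_bounded E hφ, integral_conj_symm]

lemma bounded_symm (hφ : IsBoundedMeasurable φ) (g f : H) :
    ⟪E.bounded φ g, f⟫_ℂ = ⟪g, E.bounded φ f⟫_ℂ := by
  rw [bounded_inner E hφ, inner_bounded E hφ]

/-- On a complex space an operator is determined by its quadratic form, so linear identities of the
calculus reduce to identities between integrals against `dE_{f,f}`. -/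
lemma bounded_eq_of_forall_inner {B : H →L[ℂ] H} (hφ : IsBoundedMeasurable φ)
    (h : ∀ f, ⟪f, B f⟫_ℂ = ((∫ x, φ x ∂(E.meas f) : ℝ) : ℂ)) : E.bounded φ = B := by
  refine (ContinuousLinearMap.coe_inj).1 ((ext_inner_map _ _).1 fun f => ?_)
  have h1 : ⟪E.bounded φ f, f⟫_ℂ = ⟪f, B f⟫_ℂ := by
    rw [bounded_inner E hφ, integral_self, h]
  have h2 : (starRingEnd ℂ) ⟪f, B f⟫_ℂ = ⟪f, B f⟫_ℂ := by rw [h, Complex.conj_ofReal]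
  rw [inner_conj_symm] at h2
  exact h1.trans h2.symm

lemma inner_bounded_self (hφ : IsBoundedMeasurable φ) (f : H) :
    ⟪f, E.bounded φ f⟫_ℂ = ((∫ x, φ x ∂(E.meas f) : ℝ) : ℂ) := by
  rw [inner_bounded E hφ, integral_self]

lemma bounded_add (hφ : IsBoundedMeasurable φ) (hψ : IsBoundedMeasurable ψ) :
    E.bounded (fun x => φ x + ψ x) = E.bounded φ + E.bounded ψ := by
  refine E.bounded_eq_of_forall_inner (hφ.add hψ) fun f => ?_
  rw [add_apply, inner_add_right, inner_bounded_self E hφ,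
    inner_bounded_self E hψ, integral_add (hφ.integrable _) (hψ.integrable _)]
  push_cast; rfl

lemma bounded_const (c : ℝ) : E.bounded (fun _ => c) = (c : ℂ) • (1 : H →L[ℂ] H) := by
  refine E.bounded_eq_of_forall_inner (.const c) fun f => ?_
  rw [integral_const, meas_real_univ]
  simp [mul_comm]

lemma bounded_const_mul (c : ℝ) (hφ : IsBoundedMeasurable φ) :
    E.bounded (fun x => c * φ x) = (c : ℂ) • E.bounded φ := by
  refine E.bounded_eq_of_forall_inner (hφ.const_mul c) fun f => ?_
  rw [integral_const_mul, smul_apply, inner_smul_right,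
    inner_bounded_self E hφ]
  push_cast; rfl

lemma bounded_congr (hφ : IsBoundedMeasurable φ) (hψ : IsBoundedMeasurable ψ)
    (h : ∀ f, φ =ᵐ[E.meas f] ψ) : E.bounded φ = E.bounded ψ := by
  refine E.bounded_eq_of_forall_inner hφ fun f => ?_
  rw [inner_bounded_self E hψ, integral_congr_ae (h f)]

lemma dist_add_sub_dist_sub (g f : H) (t : ℝ) :
    E.dist (g + f) t - E.dist (g - f) t = 4 * (⟪g, E.proj t f⟫_ℂ).re := by
  have h := E.dist_add_sub g ((-1 : ℂ) • f) t
  rw [dist_smul, neg_one_smul, ← sub_eq_add_neg] at h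
  rw [h, dist_add_sub]
  simp
  ring

/-- Compression by `E(t)` restricts the integrals to `(-∞, t]`. -/
lemma integral_proj_right_re (hφ : IsBoundedMeasurable φ) (g f : H) (t : ℝ) :
    4 * (E.integral φ g (E.proj t f)).re =
      (∫ x in Iic t, φ x ∂(E.meas (g + f))) - ∫ x in Iic t, φ x ∂(E.meas (g - f)) := by
  -- At the level of distribution functions both differences equal `4 Re (g, E(s)E(t)f)`, since
  -- `E(t)E(s)E(t) = E(s)E(t)`.
  have key := E.sum_integral_eq_zero (φ := φ) (ι := Fin 4) ![1, -1, -1, 1]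
    ![g + E.proj t f, g - E.proj t f, E.proj t (g + f), E.proj t (g - f)]
    (fun i => hφ.integrable _) (fun s => by
      have h1 := E.dist_add_sub_dist_sub g (E.proj t f) s
      have h2 := E.dist_add_sub_dist_sub (E.proj t g) (E.proj t f) s
      have h3 : ⟪E.proj t g, E.proj s (E.proj t f)⟫_ℂ = ⟪g, E.proj s (E.proj t f)⟫_ℂ := by
        rw [inner_proj_left, proj_comm, proj_apply_of_le E le_rfl]
      rw [h3] at h2
      simp only [Fin.sum_univ_four, Matrix.cons_val, map_add, map_sub]
      linarith)
  simp only [Fin.sum_univ_four, Matrix.cons_val, meas_proj] at key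
  rw [integral_re]
  linarith

/-- Multiplicativity of the bounded functional calculus, in weak form. -/
lemma bounded_inner_bounded (hφ : IsBoundedMeasurable φ) (hψ : IsBoundedMeasurable ψ) (g f : H) :
    ⟪E.bounded φ g, E.bounded ψ f⟫_ℂ = E.integral (fun x => φ x * ψ x) g f := by
  have hre : ∀ f, (⟪E.bounded φ g, E.bounded ψ f⟫_ℂ).re =
      (E.integral (fun x => φ x * ψ x) g f).re := fun f => by
    rw [inner_bounded E hψ, integral_re, integral_re]
    congr 1
    -- This is `d(φ(E)g, E(·)f) = φ d(g, E(·)f)`: the mass of `(-∞, t]` on the left is `(g,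
    -- φ(E)E(t)f)`, and `E(t)` cuts the integral of `φ` off at `t`.
    refine integral_sub_integral_eq_of_Iic hφ hψ fun t => ?_
    rw [← integral_proj_right_re E hφ, meas_real_Iic, meas_real_Iic, dist_add_sub_dist_sub,
      bounded_inner E hφ]
  apply Complex.ext (hre f)
  have := hre (Complex.I • f)
  rw [integral_im_eq, ← this, map_smul, inner_smul_right]
  simp

lemma bounded_mul (hφ : IsBoundedMeasurable φ) (hψ : IsBoundedMeasurable ψ) :
    E.bounded (fun x => φ x * ψ x) = E.bounded φ ∘L E.bounded ψ := by
  ext f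
  refine ext_inner_left ℂ fun g => ?_
  rw [inner_bounded E (hφ.mul hψ), ContinuousLinearMap.comp_apply, ← bounded_symm E hφ,
    bounded_inner_bounded E hφ hψ]

lemma norm_sq_bounded (hφ : IsBoundedMeasurable φ) (f : H) :
    ‖E.bounded φ f‖ ^ 2 = ∫ x, φ x ^ 2 ∂(E.meas f) := by
  have h := E.bounded_inner_bounded hφ hφ f f
  rw [integral_self, inner_self_eq_norm_sq_to_K] at h
  simp only [← pow_two] at h
  apply Complex.ofReal_injective
  rw [← h]
  push_cast
  rfl

lemma integral_indicator_one (S : Set ℝ) (hS : MeasurableSet S) (f : H) :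
    ∫ x, S.indicator (fun _ => (1 : ℝ)) x ∂(E.meas f) = (E.meas f).real S := by
  rw [integral_indicator hS]; simp

lemma bounded_indicator_Iic (t : ℝ) :
    E.bounded ((Iic t).indicator fun _ => 1) = E.proj t := by
  refine E.bounded_eq_of_forall_inner ((IsBoundedMeasurable.const 1).indicator measurableSet_Iic)
    fun f => ?_
  rw [integral_indicator_one E _ measurableSet_Iic, meas_real_Iic, dist_eq_norm_sq]
  rw [← E.proj_apply_of_le le_rfl f, ← inner_proj_left, inner_self_eq_norm_sq_to_K]
  rw [E.proj_apply_of_le le_rfl f]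
  norm_cast

lemma proj_bounded (hφ : IsBoundedMeasurable φ) (t : ℝ) (f : H) :
    E.proj t (E.bounded φ f) = E.bounded φ (E.proj t f) := by
  have h1 : IsBoundedMeasurable ((Iic t).indicator fun _ => (1 : ℝ)) :=
    (IsBoundedMeasurable.const 1).indicator measurableSet_Iic
  rw [← bounded_indicator_Iic, ← ContinuousLinearMap.comp_apply, ← ContinuousLinearMap.comp_apply,
    ← bounded_mul E h1 hφ, ← bounded_mul E hφ h1]
  simp only [mul_comm]

/-- `E(t)` commutes with `φ(E)`, so the distribution function is `‖φ(E)E(t)f‖²`, the integral of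
`φ²` over `(-∞, t]`. This decides which vectors `φ(E)f` lie in the domain of an unbounded function.
-/
lemma meas_bounded (hφ : IsBoundedMeasurable φ) (f : H) :
    E.meas (E.bounded φ f) = (E.meas f).withDensity fun x => ENNReal.ofReal (φ x ^ 2) := by
  refine Measure.ext_of_Iic _ _ fun t => ?_
  have h2 : IsBoundedMeasurable fun x => φ x ^ 2 := by simpa only [pow_two] using hφ.mul hφ
  rw [meas_Iic, dist_eq_norm_sq, proj_bounded E hφ, norm_sq_bounded E hφ, meas_proj,
    withDensity_apply _ measurableSet_Iic, ofReal_integral_eq_lintegral_ofReal (h2.integrable _)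
      (ae_of_all _ fun x => sq_nonneg _)]

end SpectralFamily

namespace SpectralFamily

variable (E : SpectralFamily H) {φ ψ : ℝ → ℝ}

/-! ### Unbounded functions of a spectral family -/

lemma tendsto_integral {φn : ℕ → ℝ → ℝ} (hφn : ∀ n, Measurable (φn n))
    (hle : ∀ n x, |φn n x| ≤ |φ x|) (hlim : ∀ x, Tendsto (fun n => φn n x) atTop (𝓝 (φ x)))
    {g f : H} (hg : g ∈ E.formDomain φ) (hf : f ∈ E.formDomain φ) :
    Tendsto (fun n => E.integral (φn n) g f) atTop (𝓝 (E.integral φ g f)) := by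
  have key : ∀ h ∈ E.formDomain φ, Tendsto (fun n => ((∫ x, φn n x ∂(E.meas h) : ℝ) : ℂ)) atTop
      (𝓝 ((∫ x, φ x ∂(E.meas h) : ℝ) : ℂ)) := fun h hh => by
    refine (Complex.continuous_ofReal.tendsto _).comp ?_
    refine tendsto_integral_of_dominated_convergence (fun x => |φ x|)
      (fun n => (hφn n).aestronglyMeasurable) (Integrable.abs hh)
      (fun n => ae_of_all _ (hle n)) (ae_of_all _ hlim)
  have hI : Complex.I • f ∈ E.formDomain φ := Submodule.smul_mem _ _ hf
  exact ((((key _ (add_mem hg hf)).sub (key _ (sub_mem hg hf))).add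
    (((key _ (sub_mem hg hI)).sub (key _ (add_mem hg hI))).mul_const _))).div_const _

/-- By the isometry `norm_sq_bounded`, strong convergence is convergence of `φn` in `L²(dE_{f,f})`,
which follows by domination. -/
lemma tendsto_bounded {φn : ℕ → ℝ → ℝ} {C : ℝ} (hφn : ∀ n, Measurable (φn n))
    (hC : ∀ n x, |φn n x| ≤ C) (hψ : IsBoundedMeasurable ψ)
    (hlim : ∀ x, Tendsto (fun n => φn n x) atTop (𝓝 (ψ x))) (f : H) :
    Tendsto (fun n => E.bounded (φn n) f) atTop (𝓝 (E.bounded ψ f)) := by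
  obtain ⟨D, hD⟩ := hψ.bounded
  have hb : ∀ n, IsBoundedMeasurable (φn n) := fun n => ⟨hφn n, C, hC n⟩
  have hd : ∀ n, IsBoundedMeasurable fun x => φn n x + (-1) * ψ x :=
    fun n => (hb n).add (hψ.const_mul _)
  rw [tendsto_iff_norm_sub_tendsto_zero]
  have h2 : Tendsto (fun n => ‖E.bounded (φn n) f - E.bounded ψ f‖ ^ 2) atTop (𝓝 0) := by
    have h3 : ∀ n, ‖E.bounded (φn n) f - E.bounded ψ f‖ ^ 2 =
        ∫ x, (φn n x + (-1) * ψ x) ^ 2 ∂(E.meas f) := fun n => by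
      rw [← norm_sq_bounded E (hd n), bounded_add E (hb n) (hψ.const_mul _),
        bounded_const_mul E _ hψ]
      simp [sub_eq_add_neg]
    simp only [h3]
    have h4 : Tendsto (fun n => ∫ x, (φn n x + (-1) * ψ x) ^ 2 ∂(E.meas f)) atTop
        (𝓝 (∫ x, (0 : ℝ) ∂(E.meas f))) := by
      refine tendsto_integral_of_dominated_convergence (fun _ => (C + D) ^ 2)
        (fun n => ((hd n).measurable.pow_const 2).aestronglyMeasurable) (integrable_const _)
        (fun n => ae_of_all _ fun x => ?_) (ae_of_all _ fun x => ?_)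
      · rw [Real.norm_of_nonneg (sq_nonneg _), ← sq_abs]
        refine pow_le_pow_left₀ (abs_nonneg _) ((abs_add_le _ _).trans ?_) 2
        rw [abs_mul, abs_neg, abs_one, one_mul]
        exact add_le_add (hC n x) (hD x)
      · have := ((hlim x).add_const ((-1) * ψ x)).pow 2
        simpa using this
    simpa using h4
  have := h2.sqrt
  simpa [Real.sqrt_sq] using this

variable (φ) in
/-- The truncation of `φ` to the set where `|φ| ≤ n`. -/
def truncation (n : ℕ) : ℝ → ℝ := {x | |φ x| ≤ n}.indicator φ

lemma truncation_apply (n : ℕ) (x : ℝ) :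
    truncation φ n x = φ x * {x | |φ x| ≤ n}.indicator (fun _ => (1 : ℝ)) x := by
  by_cases h : x ∈ {x | |φ x| ≤ n} <;> simp [truncation, h]

lemma measurableSet_abs_le (hφ : Measurable φ) (n : ℕ) : MeasurableSet {x | |φ x| ≤ n} :=
  measurableSet_le hφ.abs measurable_const

lemma isBoundedMeasurable_truncation (hφ : Measurable φ) (n : ℕ) :
    IsBoundedMeasurable (truncation φ n) := by
  refine ⟨hφ.indicator (measurableSet_abs_le hφ n), n, fun x => ?_⟩
  rw [truncation]
  by_cases h : x ∈ {x | |φ x| ≤ n}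
  · rw [indicator_of_mem h]; exact h
  · rw [indicator_of_notMem h]; simp

lemma abs_truncation_le (n : ℕ) (x : ℝ) : |truncation φ n x| ≤ |φ x| := by
  rw [truncation]
  by_cases h : x ∈ {x | |φ x| ≤ n}
  · rw [indicator_of_mem h]
  · rw [indicator_of_notMem h]; simp

lemma eventually_mem_abs_le (φ : ℝ → ℝ) (x : ℝ) : ∀ᶠ n : ℕ in atTop, x ∈ {x | |φ x| ≤ n} := by
  obtain ⟨N, hN⟩ := exists_nat_ge |φ x|
  filter_upwards [eventually_ge_atTop N] with n hn
  exact hN.trans (by exact_mod_cast hn)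

lemma tendsto_truncation (φ : ℝ → ℝ) (x : ℝ) :
    Tendsto (fun n => truncation φ n x) atTop (𝓝 (φ x)) := by
  refine tendsto_const_nhds.congr' ?_
  filter_upwards [eventually_mem_abs_le φ x] with n hn
  rw [truncation, indicator_of_mem (show x ∈ {x | |φ x| ≤ (n : ℝ)} from hn)]

lemma bounded_mem_opDomain (hφ : Measurable φ) (hψ : IsBoundedMeasurable ψ)
    (h : IsBoundedMeasurable fun x => φ x * ψ x) (f : H) : E.bounded ψ f ∈ E.opDomain φ := by
  change MemLp φ 2 (E.meas (E.bounded ψ f))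
  rw [memLp_two_iff_integrable_sq hφ.aestronglyMeasurable, meas_bounded E hψ,
    integrable_withDensity_iff_integrable_smul' (hψ.measurable.pow_const 2).ennreal_ofReal
      (ae_of_all _ fun x => ENNReal.ofReal_lt_top)]
  refine ((h.mul h).integrable (E.meas f)).congr (ae_of_all _ fun x => ?_)
  simp only [smul_eq_mul]
  rw [ENNReal.toReal_ofReal (sq_nonneg _)]
  ring

/-- The spectral cut-offs of `f` to `{|φ| ≤ n}` lie in the domain and converge to `f`. -/
lemma dense_opDomain (hφ : Measurable φ) : Dense (E.opDomain φ : Set H) := by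
  intro f
  have hb : ∀ n : ℕ, IsBoundedMeasurable ({x | |φ x| ≤ n}.indicator fun _ => (1 : ℝ)) :=
    fun n => (IsBoundedMeasurable.const 1).indicator (measurableSet_abs_le hφ n)
  have ht := E.tendsto_bounded (ψ := fun _ => 1) (C := 1) (fun n => (hb n).measurable)
    (fun n x => by
      by_cases h : x ∈ {x | |φ x| ≤ n}
      · rw [indicator_of_mem h]; simp
      · rw [indicator_of_notMem h]; simp) (.const 1)
    (fun x => tendsto_const_nhds.congr' (by
      filter_upwards [eventually_mem_abs_le φ x] with n hn
      rw [indicator_of_mem (show x ∈ {x | |φ x| ≤ (n : ℝ)} from hn)])) f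
  rw [bounded_const] at ht
  simp only [Complex.ofReal_one, one_smul, one_apply_eq_self] at ht
  refine mem_closure_of_tendsto ht (Eventually.of_forall fun n => ?_)
  refine E.bounded_mem_opDomain hφ (hb n) ?_ f
  simp only [← truncation_apply]
  exact isBoundedMeasurable_truncation hφ n

lemma integrable_sq_of_mem_opDomain {f : H} (hf : f ∈ E.opDomain φ) :
    Integrable (fun x => φ x ^ 2) (E.meas f) :=
  have hf' : MemLp φ 2 (E.meas f) := hf
  (memLp_two_iff_integrable_sq hf'.1).1 hf'

/-- The sets `{|φ| ≤ n}` are nested, so `‖φ_n(E)f - φ_m(E)f‖²` is a difference of two terms of the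
convergent sequence `∫ φ_n² dE_{f,f}`; the sequence is therefore Cauchy. -/
lemma exists_tendsto_truncation (hφ : Measurable φ) {f : H} (hf : f ∈ E.opDomain φ) :
    ∃ v, Tendsto (fun n => E.bounded (truncation φ n) f) atTop (𝓝 v) := by
  have hb := isBoundedMeasurable_truncation hφ
  have hlim : Tendsto (fun n => ∫ x, truncation φ n x ^ 2 ∂(E.meas f)) atTop
      (𝓝 (∫ x, φ x ^ 2 ∂(E.meas f))) := by
    refine tendsto_integral_of_dominated_convergence (fun x => φ x ^ 2)
      (fun n => ((hb n).measurable.pow_const 2).aestronglyMeasurable)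
      (E.integrable_sq_of_mem_opDomain hf) (fun n => ae_of_all _ fun x => ?_)
      (ae_of_all _ fun x => (tendsto_truncation φ x).pow 2)
    rw [Real.norm_of_nonneg (sq_nonneg _)]
    exact sq_le_sq.2 (abs_truncation_le n x)
  have hdiff : ∀ m n, m ≤ n → ‖E.bounded (truncation φ n) f - E.bounded (truncation φ m) f‖ ^ 2 =
      (∫ x, truncation φ n x ^ 2 ∂(E.meas f)) - ∫ x, truncation φ m x ^ 2 ∂(E.meas f) := by
    intro m n hmn
    have hd := (hb n).add ((hb m).const_mul (-1))
    have h1 := E.norm_sq_bounded hd f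
    rw [bounded_add E (hb n) ((hb m).const_mul (-1)), bounded_const_mul E _ (hb m)] at h1
    simp only [Complex.ofReal_neg, Complex.ofReal_one, neg_smul, one_smul,
      ← sub_eq_add_neg] at h1
    rw [← sub_apply, h1, ← integral_sub]
    · refine integral_congr_ae (ae_of_all _ fun x => ?_)
      simp only [truncation_apply]
      by_cases hm : |φ x| ≤ m
      · have hn : |φ x| ≤ n := hm.trans (by exact_mod_cast hmn)
        simp [indicator, hm, hn]
      · simp [indicator, hm]
    · simpa only [pow_two] using ((hb n).mul (hb n)).integrable (E.meas f)
    · simpa only [pow_two] using ((hb m).mul (hb m)).integrable (E.meas f)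
  refine cauchySeq_tendsto_of_complete (Metric.cauchySeq_iff'.2 fun ε hε => ?_)
  obtain ⟨N, hN⟩ := Metric.cauchySeq_iff'.1 hlim.cauchySeq (ε ^ 2) (by positivity)
  refine ⟨N, fun n hn => ?_⟩
  have := (le_abs_self _).trans_lt (hN n hn)
  rw [← hdiff N n hn] at this
  rw [dist_eq_norm]
  exact lt_of_pow_lt_pow_left₀ 2 hε.le this

lemma inner_eq_integral_of_tendsto_truncation (hφ : Measurable φ) {f v g : H}
    (hf : f ∈ E.formDomain φ) (hg : g ∈ E.formDomain φ)
    (hv : Tendsto (fun n => E.bounded (truncation φ n) f) atTop (𝓝 v)) :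
    ⟪g, v⟫_ℂ = E.integral φ g f := by
  have h1 := ((innerSL ℂ g).continuous.tendsto v).comp hv
  have h2 := E.tendsto_integral (φ := φ) (φn := truncation φ)
    (fun n => (isBoundedMeasurable_truncation hφ n).measurable) abs_truncation_le
    (tendsto_truncation φ) hg hf
  refine tendsto_nhds_unique h1 (h2.congr fun n => ?_)
  exact (E.inner_bounded (isBoundedMeasurable_truncation hφ n) g f).symm

lemma eq_zero_of_forall_mem_opDomain (hφ : Measurable φ) {v : H}
    (hv : ∀ g ∈ E.opDomain φ, ⟪g, v⟫_ℂ = 0) : v = 0 :=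
  (E.dense_opDomain hφ).eq_zero_of_inner_right ℂ fun g hg => hv g hg

/-- The limit of the truncations supplies a value at each point of the domain; density of the domain
makes the value unique, so the relation defining `op` really is a graph. -/
lemma op_aux (hφ : Measurable φ) : (E.op φ).domain = E.opDomain φ ∧
    ∀ f : (E.op φ).domain, ∀ g ∈ E.opDomain φ, ⟪g, E.op φ f⟫_ℂ = E.integral φ g f := by
  constructor
  · apply le_antisymm
    · rintro f hf
      rw [op, Submodule.toLinearPMap_domain] at hf
      obtain ⟨p, hp, rfl⟩ := hf
      exact hp.1
    · intro f hf
      rw [op, Submodule.toLinearPMap_domain]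
      obtain ⟨v, hv⟩ := E.exists_tendsto_truncation hφ hf
      exact ⟨(f, v), ⟨hf, fun g hg => E.inner_eq_integral_of_tendsto_truncation hφ
        (E.opDomain_le_formDomain φ hf) (E.opDomain_le_formDomain φ hg) hv⟩, rfl⟩
  · intro f g hg
    refine (Submodule.mem_graph_toLinearPMap (fun x hx hx' => ?_) f).2 g hg
    refine E.eq_zero_of_forall_mem_opDomain hφ fun g hg => ?_
    rw [hx.2 g hg, hx']
    have := integral_smul_right (E := E) 0 (E.opDomain_le_formDomain φ hg)
      (zero_mem (E.formDomain φ))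
    simpa using this

lemma op_domain (hφ : Measurable φ) : (E.op φ).domain = E.opDomain φ := (E.op_aux hφ).1

lemma inner_op (hφ : Measurable φ) {g : H} (hg : g ∈ E.opDomain φ) (f : (E.op φ).domain) :
    ⟪g, E.op φ f⟫_ℂ = E.integral φ g f := (E.op_aux hφ).2 f g hg

lemma op_eq_of_forall_inner (hφ : Measurable φ) (f : (E.op φ).domain) {v : H}
    (hv : ∀ g ∈ E.opDomain φ, ⟪g, v⟫_ℂ = E.integral φ g f) : E.op φ f = v := by
  rw [← sub_eq_zero]
  refine E.eq_zero_of_forall_mem_opDomain hφ fun g hg => ?_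
  rw [inner_sub_right, hv g hg, inner_op E hφ hg, sub_self]

lemma op_symm (hφ : Measurable φ) (g f : (E.op φ).domain) :
    ⟪E.op φ g, (f : H)⟫_ℂ = ⟪(g : H), E.op φ f⟫_ℂ := by
  rw [inner_op E hφ ((E.op_domain hφ).le g.2), ← inner_conj_symm,
    inner_op E hφ ((E.op_domain hφ).le f.2), integral_conj_symm]

lemma norm_sq_op (hφ : Measurable φ) (f : (E.op φ).domain) :
    ‖E.op φ f‖ ^ 2 = ∫ x, φ x ^ 2 ∂(E.meas f) := by
  have hf : (f : H) ∈ E.opDomain φ := (E.op_domain hφ).le f.2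
  have hb := isBoundedMeasurable_truncation hφ
  obtain ⟨v, hv⟩ := E.exists_tendsto_truncation hφ hf
  have hfv : E.op φ f = v := E.op_eq_of_forall_inner hφ f fun g hg =>
    E.inner_eq_integral_of_tendsto_truncation hφ (E.opDomain_le_formDomain φ hf)
      (E.opDomain_le_formDomain φ hg) hv
  rw [hfv]
  refine tendsto_nhds_unique (hv.norm.pow 2) ?_
  simp only [norm_sq_bounded E (hb _)]
  refine tendsto_integral_of_dominated_convergence (fun x => φ x ^ 2)
    (fun n => ((hb n).measurable.pow_const 2).aestronglyMeasurable)
    (E.integrable_sq_of_mem_opDomain hf) (fun n => ae_of_all _ fun x => ?_)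
    (ae_of_all _ fun x => (tendsto_truncation φ x).pow 2)
  rw [Real.norm_of_nonneg (sq_nonneg _)]
  exact sq_le_sq.2 (abs_truncation_le n x)

/-- Polarization of `norm_sq_op`. With `φ = t^{s/2}` this expresses the scalar product of the
ordinary scale as a spectral integral. -/
lemma inner_op_op (hφ : Measurable φ) (g f : (E.op φ).domain) :
    ⟪E.op φ g, E.op φ f⟫_ℂ = E.integral (fun x => φ x ^ 2) g f := by
  have hre : ∀ f : (E.op φ).domain,
      (⟪E.op φ g, E.op φ f⟫_ℂ).re = (E.integral (fun x => φ x ^ 2) g f).re := fun f => by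
    have h := re_inner_eq_norm_add_mul_self_sub_norm_sub_mul_self_div_four (𝕜 := ℂ)
      (E.op φ g) (E.op φ f)
    rw [← LinearPMap.map_add, ← LinearPMap.map_sub, ← pow_two, ← pow_two, norm_sq_op E hφ,
      norm_sq_op E hφ] at h
    rw [integral_re]
    exact h
  apply Complex.ext (hre f)
  have := hre (Complex.I • f)
  rw [LinearPMap.map_smul, inner_smul_right] at this
  rw [integral_im_eq]
  rw [Submodule.coe_smul] at this
  rw [← this]
  simp

/-- For truncations this is multiplicativity of the bounded calculus; both sides then pass to the
limit weakly. -/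
lemma op_bounded (hφ : Measurable φ) (hψ : IsBoundedMeasurable ψ)
    (h : IsBoundedMeasurable fun x => φ x * ψ x) (f : H) :
    ∃ h' : E.bounded ψ f ∈ (E.op φ).domain,
      E.op φ ⟨E.bounded ψ f, h'⟩ = E.bounded (fun x => φ x * ψ x) f := by
  have hm := E.bounded_mem_opDomain hφ hψ h f
  have hb := isBoundedMeasurable_truncation hφ
  refine ⟨(E.op_domain hφ).ge hm, E.op_eq_of_forall_inner hφ _ fun g hg => ?_⟩
  rw [inner_bounded E h]
  have h1 := E.tendsto_integral (φ := φ) (φn := truncation φ) (fun n => (hb n).measurable)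
    abs_truncation_le (tendsto_truncation φ) (E.opDomain_le_formDomain φ hg)
    (E.opDomain_le_formDomain φ hm)
  have h2 := E.tendsto_integral (φ := fun x => φ x * ψ x) (φn := fun n x => truncation φ n x * ψ x)
    (fun n => ((hb n).mul hψ).measurable)
    (fun n x => by
      rw [abs_mul, abs_mul]
      exact mul_le_mul_of_nonneg_right (abs_truncation_le n x) (abs_nonneg _))
    (fun x => (tendsto_truncation φ x).mul_const _)
    (E.mem_formDomain_of_isBoundedMeasurable h g) (E.mem_formDomain_of_isBoundedMeasurable h f)
  refine tendsto_nhds_unique h2 (h1.congr fun n => ?_)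
  rw [← inner_bounded E (hb n), ← inner_bounded E ((hb n).mul hψ), bounded_mul E (hb n) hψ,
    ContinuousLinearMap.comp_apply]

lemma bounded_op (hφ : Measurable φ) (hψ : IsBoundedMeasurable ψ)
    (h : IsBoundedMeasurable fun x => φ x * ψ x) (f : (E.op φ).domain) :
    E.bounded ψ (E.op φ f) = E.bounded (fun x => φ x * ψ x) f := by
  refine ext_inner_left ℂ fun g => ?_
  obtain ⟨h', hg⟩ := E.op_bounded hφ hψ h g
  rw [← bounded_symm E hψ, ← bounded_symm E h, ← hg]
  exact (E.op_symm hφ ⟨_, h'⟩ f).symm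

end SpectralFamily

/-! ### Resolvents -/

/-- `R` is a bounded everywhere defined inverse of `T - z`. -/
structure IsResolvent (T : H →ₗ.[ℂ] H) (z : ℂ) (R : H →L[ℂ] H) : Prop where
  right_inv : ∀ f : H, ∃ h : R f ∈ T.domain, T ⟨R f, h⟩ - z • R f = f
  left_inv : ∀ f : T.domain, R (T f - z • (f : H)) = f

omit [CompleteSpace H] in
lemma notMem_opSpectrum_iff {T : H →ₗ.[ℂ] H} {z : ℂ} :
    z ∉ opSpectrum T ↔ ∃ R, IsResolvent T z R := by
  simp only [opSpectrum, mem_ofPred_eq, not_not]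
  exact ⟨fun ⟨R, h1, h2⟩ => ⟨R, h1, h2⟩, fun ⟨R, h⟩ => ⟨R, h.1, h.2⟩⟩

namespace IsResolvent

variable {T S : H →ₗ.[ℂ] H} {z : ℂ} {R R' : H →L[ℂ] H}

omit [CompleteSpace H] in
lemma unique (h : IsResolvent T z R) (h' : IsResolvent T z R') : R = R' := by
  ext f
  obtain ⟨hf, hf'⟩ := h'.right_inv f
  have := h.left_inv ⟨R' f, hf⟩
  rwa [hf'] at this

omit [CompleteSpace H] in
-- The resolvent recovers the graph, so two operators sharing a resolvent at one point coincide.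
lemma mem_graph_iff (h : IsResolvent T z R) (p : H × H) :
    p ∈ T.graph ↔ R (p.2 - z • p.1) = p.1 := by
  rw [LinearPMap.mem_graph_iff]
  constructor
  · rintro ⟨y, h1, h2⟩
    rw [← h1, ← h2]
    exact h.left_inv y
  · intro hp
    obtain ⟨hf, hf'⟩ := h.right_inv (p.2 - z • p.1)
    refine ⟨⟨_, hf⟩, hp, ?_⟩
    rw [sub_eq_iff_eq_add.1 hf', hp, sub_add_cancel]

omit [CompleteSpace H] in
lemma operator_unique (h : IsResolvent T z R) (h' : IsResolvent S z R) : T = S :=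
  LinearPMap.eq_of_eq_graph (Submodule.ext fun p => by rw [h.mem_graph_iff, h'.mem_graph_iff])

end IsResolvent

/-- A densely defined symmetric operator with `±i` in the resolvent set is self-adjoint. -/
lemma isSelfAdjoint_of_isResolvent {T : H →ₗ.[ℂ] H} {R R' : H →L[ℂ] H}
    (hd : Dense (T.domain : Set H)) (hs : T.IsFormalAdjoint T)
    (hR : IsResolvent T Complex.I R) (hR' : IsResolvent T (-Complex.I) R') :
    IsSelfAdjoint T := by
  rw [LinearPMap.isSelfAdjoint_def]
  have hle : T ≤ T.adjoint := hs.le_adjoint hd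
  refine (LinearPMap.eq_of_le_of_domain_eq hle (le_antisymm hle.1 fun h hh => ?_)).symm
  -- The vector `u` of the domain solves `(T - i)u = (T* - i)h`; it remains to see that `u = h`.
  obtain ⟨hu, hu'⟩ := hR.right_inv (T.adjoint ⟨h, hh⟩ - Complex.I • h)
  set u := R (T.adjoint ⟨h, hh⟩ - Complex.I • h)
  have hw : h - u = 0 := by
    refine ext_inner_right ℂ fun f => ?_
    -- Every `f` is `(T + i)v`, and `h - u` is orthogonal to the range of `T + i` because `(T* -
    -- i)(h - u) = 0`.
    obtain ⟨hv, hv'⟩ := hR'.right_inv f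
    set v := R' f
    have h1 : ⟪T.adjoint ⟨h, hh⟩, v⟫_ℂ = ⟪h, T ⟨v, hv⟩⟫_ℂ :=
      LinearPMap.adjoint_isFormalAdjoint hd ⟨h, hh⟩ ⟨v, hv⟩
    have h2 : ⟪T ⟨u, hu⟩, v⟫_ℂ = ⟪u, T ⟨v, hv⟩⟫_ℂ := hs ⟨u, hu⟩ ⟨v, hv⟩
    have h3 : T ⟨u, hu⟩ = T.adjoint ⟨h, hh⟩ - Complex.I • h + Complex.I • u := by
      rw [← hu']; abel
    rw [h3, inner_add_left, inner_sub_left, h1, inner_smul_left, inner_smul_left] at h2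
    rw [← hv', inner_zero_left, inner_sub_right, inner_smul_right, inner_sub_left, inner_sub_left,
      ← h2, Complex.conj_I]
    ring
  rw [sub_eq_zero.1 hw]
  exact hu

/-! ### Resolvents, self-adjointness and spectrum of `∫ φ dE` -/

namespace SpectralFamily

variable (E : SpectralFamily H) {φ ψ : ℝ → ℝ}

/-- The function `1 / |φ - z|²`, cut off where `|φ - z| < δ`. -/
def resolventWeight (φ : ℝ → ℝ) (z : ℂ) (δ : ℝ) (x : ℝ) : ℝ :=
  -- The maximum keeps the weight bounded on the null set where `φ` may come close to `z`.
  (max ((φ x - z.re) ^ 2 + z.im ^ 2) (δ ^ 2))⁻¹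

section

variable {z : ℂ} {δ : ℝ}

lemma resolventWeight_pos (hδ : 0 < δ) (x : ℝ) : 0 < resolventWeight φ z δ x :=
  inv_pos.2 (lt_max_of_lt_right (by positivity))

lemma measurable_resolventWeight (hφ : Measurable φ) : Measurable (resolventWeight φ z δ) :=
  ((((hφ.sub_const _).pow_const 2).add_const _).max measurable_const).inv

lemma isBoundedMeasurable_resolventWeight (hφ : Measurable φ) (hδ : 0 < δ) :
    IsBoundedMeasurable (resolventWeight φ z δ) := by
  refine ⟨measurable_resolventWeight hφ, (δ ^ 2)⁻¹, fun x => ?_⟩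
  rw [abs_of_pos (resolventWeight_pos hδ x)]
  exact inv_anti₀ (by positivity) (le_max_right _ _)

lemma isBoundedMeasurable_sub_mul_resolventWeight (hφ : Measurable φ) (hδ : 0 < δ) :
    IsBoundedMeasurable fun x => (φ x - z.re) * resolventWeight φ z δ x := by
  refine ⟨(hφ.sub_const _).mul (measurable_resolventWeight hφ), δ⁻¹, fun x => ?_⟩
  rw [abs_mul, abs_of_pos (resolventWeight_pos hδ x), resolventWeight, ← div_eq_mul_inv,
    div_le_iff₀ (lt_max_of_lt_right (by positivity)), ← div_eq_inv_mul, le_div_iff₀ hδ]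
  have h1 := le_max_left ((φ x - z.re) ^ 2 + z.im ^ 2) (δ ^ 2)
  have h2 := le_max_right ((φ x - z.re) ^ 2 + z.im ^ 2) (δ ^ 2)
  nlinarith [sq_abs (φ x - z.re), sq_nonneg (|φ x - z.re| - δ), sq_nonneg z.im]

lemma isBoundedMeasurable_sub_sq_mul_resolventWeight (hφ : Measurable φ) (hδ : 0 < δ) :
    IsBoundedMeasurable fun x => (φ x - z.re) ^ 2 * resolventWeight φ z δ x := by
  refine ⟨((hφ.sub_const _).pow_const 2).mul (measurable_resolventWeight hφ), 1, fun x => ?_⟩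
  rw [abs_of_nonneg (mul_nonneg (sq_nonneg _) (resolventWeight_pos hδ x).le), resolventWeight,
    ← div_eq_mul_inv, div_le_one (lt_max_of_lt_right (by positivity))]
  exact le_trans (by nlinarith [sq_nonneg z.im]) (le_max_left _ _)

variable (φ z δ) in
/-- The resolvent of `∫ φ dE` at `z`, if `φ` stays at distance at least `δ` from `z`. -/
def resolvent : H →L[ℂ] H :=
  -- Real and imaginary parts of `1/(φ - z) = (φ - z̄)/|φ - z|²` are treated separately, as the
  -- calculus is built for real functions.
  E.bounded (fun x => (φ x - z.re) * resolventWeight φ z δ x) +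
    (z.im * Complex.I : ℂ) • E.bounded (resolventWeight φ z δ)

/-- Both the real and the imaginary part of `1/(φ - z)` stay bounded after multiplication by `φ`, so
`op_bounded` and `bounded_op` reduce the two inverse identities to the same identity `main` between
bounded operators. -/
lemma isResolvent_op (hφ : Measurable φ) (hδ : 0 < δ)
    (h : ∀ f, ∀ᵐ x ∂(E.meas f), δ ≤ ‖(φ x : ℂ) - z‖) :
    IsResolvent (E.op φ) z (E.resolvent φ z δ) := by
  have hQ : IsBoundedMeasurable (resolventWeight φ z δ) :=
    isBoundedMeasurable_resolventWeight hφ hδ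
  have hP : IsBoundedMeasurable fun x => (φ x - z.re) * resolventWeight φ z δ x :=
    isBoundedMeasurable_sub_mul_resolventWeight hφ hδ
  have hX : IsBoundedMeasurable fun x => (φ x - z.re) ^ 2 * resolventWeight φ z δ x :=
    isBoundedMeasurable_sub_sq_mul_resolventWeight hφ hδ
  have eQ : (fun x => φ x * resolventWeight φ z δ x) = fun x =>
      (φ x - z.re) * resolventWeight φ z δ x + z.re * resolventWeight φ z δ x := by
    ext x; ring
  have eP : (fun x => φ x * ((φ x - z.re) * resolventWeight φ z δ x)) = fun x =>
      (φ x - z.re) ^ 2 * resolventWeight φ z δ x +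
        z.re * ((φ x - z.re) * resolventWeight φ z δ x) := by
    ext x; ring
  have hφQ : IsBoundedMeasurable fun x => φ x * resolventWeight φ z δ x := by
    rw [eQ]; exact hP.add (hQ.const_mul _)
  have hφP : IsBoundedMeasurable fun x => φ x * ((φ x - z.re) * resolventWeight φ z δ x) := by
    rw [eP]; exact hX.add (hP.const_mul _)
  have bQ : E.bounded (fun x => φ x * resolventWeight φ z δ x) =
      E.bounded (fun x => (φ x - z.re) * resolventWeight φ z δ x) +
        (z.re : ℂ) • E.bounded (resolventWeight φ z δ) := by
    rw [eQ, bounded_add E hP (hQ.const_mul _), bounded_const_mul E _ hQ]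
  have bP : E.bounded (fun x => φ x * ((φ x - z.re) * resolventWeight φ z δ x)) =
      E.bounded (fun x => (φ x - z.re) ^ 2 * resolventWeight φ z δ x) +
        (z.re : ℂ) • E.bounded (fun x => (φ x - z.re) * resolventWeight φ z δ x) := by
    rw [eP, bounded_add E hX (hP.const_mul _), bounded_const_mul E _ hP]
  -- The algebraic core: `|φ - z|²` times the weight is `1` almost everywhere, since there the
  -- cut-off is inactive.
  have b1 : E.bounded (fun x => (φ x - z.re) ^ 2 * resolventWeight φ z δ x) +
      ((z.im ^ 2 : ℝ) : ℂ) • E.bounded (resolventWeight φ z δ) = 1 := by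
    rw [← bounded_const_mul E _ hQ, ← bounded_add E hX (hQ.const_mul _)]
    have := E.bounded_const 1
    rw [Complex.ofReal_one, one_smul] at this
    rw [← this]
    refine E.bounded_congr (hX.add (hQ.const_mul _)) (.const 1) fun f => ?_
    filter_upwards [h f] with x hx
    have hn : ‖(φ x : ℂ) - z‖ ^ 2 = (φ x - z.re) ^ 2 + z.im ^ 2 := by
      rw [Complex.sq_norm, Complex.normSq_apply]
      simp; ring
    have hm : δ ^ 2 ≤ (φ x - z.re) ^ 2 + z.im ^ 2 := by
      rw [← hn]; exact pow_le_pow_left₀ hδ.le hx 2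
    rw [← add_mul, resolventWeight, max_eq_left hm, mul_inv_cancel₀]
    exact ((by positivity : 0 < δ ^ 2).trans_le hm).ne'
  have hz : ∀ v : H, z • v = (z.re : ℂ) • v + (z.im * Complex.I : ℂ) • v := fun v => by
    rw [← add_smul, Complex.re_add_im]
  have hc : ((z.im ^ 2 : ℝ) : ℂ) = -((z.im * Complex.I : ℂ) * (z.im * Complex.I : ℂ)) := by
    push_cast
    linear_combination (z.im : ℂ) ^ 2 * Complex.I_mul_I
  have main : ∀ f, E.bounded (fun x => φ x * ((φ x - z.re) * resolventWeight φ z δ x)) f +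
      (z.im * Complex.I : ℂ) • E.bounded (fun x => φ x * resolventWeight φ z δ x) f -
      z • E.resolvent φ z δ f = f := by
    intro f
    have h1 := congrArg (fun A : H →L[ℂ] H => A f) b1
    simp only [add_apply, smul_apply, one_apply_eq_self, hc] at h1
    rw [bP, bQ, resolvent, hz]
    simp only [add_apply, smul_apply]
    refine Eq.trans ?_ h1
    module
  constructor
  · intro f
    obtain ⟨m1, e1⟩ := E.op_bounded hφ hP hφP f
    obtain ⟨m2, e2⟩ := E.op_bounded hφ hQ hφQ f
    refine ⟨add_mem m1 (Submodule.smul_mem _ (z.im * Complex.I : ℂ) m2), ?_⟩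
    have h1 := LinearPMap.map_add (E.op φ) ⟨_, m1⟩ ((z.im * Complex.I : ℂ) • ⟨_, m2⟩)
    rw [LinearPMap.map_smul, e1, e2] at h1
    exact (congrArg (· - z • E.resolvent φ z δ f) h1).trans (main f)
  · intro f
    rw [map_sub, map_smul]
    refine (congrArg (· - z • E.resolvent φ z δ f) ?_).trans (main f)
    rw [resolvent, add_apply, smul_apply, bounded_op E hφ hP hφP, bounded_op E hφ hQ hφQ]

end

lemma isFormalAdjoint_op (hφ : Measurable φ) : (E.op φ).IsFormalAdjoint (E.op φ) :=
  fun g f => E.op_symm hφ g f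

lemma abs_im_le_norm_ofReal_sub (x : ℝ) (z : ℂ) : |z.im| ≤ ‖(x : ℂ) - z‖ := by
  have := Complex.abs_im_le_norm ((x : ℂ) - z)
  simpa using this

lemma isSelfAdjoint_op (hφ : Measurable φ) : IsSelfAdjoint (E.op φ) := by
  refine isSelfAdjoint_of_isResolvent (R := E.resolvent φ Complex.I 1)
    (R' := E.resolvent φ (-Complex.I) 1) ?_ (E.isFormalAdjoint_op hφ)
    (E.isResolvent_op hφ one_pos fun f => ae_of_all _ fun x => ?_)
    (E.isResolvent_op hφ one_pos fun f => ae_of_all _ fun x => ?_)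
  · rw [op_domain E hφ]; exact E.dense_opDomain hφ
  · simpa using abs_im_le_norm_ofReal_sub (φ x) Complex.I
  · simpa using abs_im_le_norm_ofReal_sub (φ x) (-Complex.I)

/-- The spectrum of `∫ φ dE` lies in `[c, ∞)` if `φ ≥ c` almost everywhere. -/
lemma opSpectrum_op_subset (hφ : Measurable φ) {c : ℝ} (h : ∀ f, ∀ᵐ x ∂(E.meas f), c ≤ φ x) :
    opSpectrum (E.op φ) ⊆ Complex.ofReal '' Ici c := by
  intro z hz
  by_contra hzc
  refine notMem_opSpectrum_iff.2 ?_ hz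
  -- The distance from `z` to the values of `φ` is at least `c - z` for real `z < c`, and at least
  -- `|Im z|` otherwise.
  by_cases him : z.im = 0
  · have hre : z.re < c := by
      by_contra hre
      exact hzc ⟨z.re, not_lt.1 hre, Complex.ext rfl (by simp [him])⟩
    refine ⟨_, E.isResolvent_op (δ := c - z.re) hφ (sub_pos.2 hre) fun f => ?_⟩
    filter_upwards [h f] with x hx
    have := Complex.re_le_norm ((φ x : ℂ) - z)
    simp only [Complex.sub_re, Complex.ofReal_re] at this
    linarith
  · exact ⟨_, E.isResolvent_op hφ (abs_pos.2 him) fun f => ae_of_all _ fun x =>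
      abs_im_le_norm_ofReal_sub (φ x) z⟩

end SpectralFamily

/-! ### Uniqueness of the spectral family -/

namespace SpectralFamily

variable {E F : SpectralFamily H}

lemma isBoundedMeasurable_coe (g : BoundedContinuousFunction ℝ ℝ) : IsBoundedMeasurable g :=
  ⟨g.continuous.measurable, ‖g‖, g.norm_coe_le_norm⟩

variable (E F) in
/-- The algebra of bounded continuous functions at which two bounded functional calculi agree. -/
def agreementAlgebra : StarSubalgebra ℝ (BoundedContinuousFunction ℝ ℝ) where
  carrier := {g | E.bounded g = F.bounded g}
  mul_mem' {g h} hg hh := by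
    have hg' := isBoundedMeasurable_coe g
    have hh' := isBoundedMeasurable_coe h
    change E.bounded (fun x => g x * h x) = F.bounded fun x => g x * h x
    rw [bounded_mul E hg' hh', bounded_mul F hg' hh', hg, hh]
  add_mem' {g h} hg hh := by
    have hg' := isBoundedMeasurable_coe g
    have hh' := isBoundedMeasurable_coe h
    change E.bounded (fun x => g x + h x) = F.bounded fun x => g x + h x
    rw [bounded_add E hg' hh', bounded_add F hg' hh', hg, hh]
  algebraMap_mem' c := by
    have hc : (algebraMap ℝ (BoundedContinuousFunction ℝ ℝ) c : ℝ → ℝ) = fun _ => c := by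
      ext x
      simp [BoundedContinuousFunction.algebraMap_apply]
    change E.bounded (algebraMap ℝ (BoundedContinuousFunction ℝ ℝ) c) =
      F.bounded (algebraMap ℝ (BoundedContinuousFunction ℝ ℝ) c)
    rw [hc, bounded_const, bounded_const]
  star_mem' {g} hg := by
    change E.bounded (star g) = F.bounded (star g)
    rw [star_trivial]; exact hg

/-- The quadratic forms of the two bounded operators are real, so the real and imaginary parts of
the quadratic form of the resolvent separate them. -/
lemma bounded_eq_of_resolvent_eq {φ : ℝ → ℝ} (hφ : Measurable φ)
    (h : E.resolvent φ Complex.I 1 = F.resolvent φ Complex.I 1) :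
    E.bounded (fun x => φ x * resolventWeight φ Complex.I 1 x) =
      F.bounded (fun x => φ x * resolventWeight φ Complex.I 1 x) ∧
    E.bounded (resolventWeight φ Complex.I 1) = F.bounded (resolventWeight φ Complex.I 1) := by
  have hQ : IsBoundedMeasurable (resolventWeight φ Complex.I 1) :=
    isBoundedMeasurable_resolventWeight hφ one_pos
  have hP : IsBoundedMeasurable fun x => φ x * resolventWeight φ Complex.I 1 x := by
    simpa using isBoundedMeasurable_sub_mul_resolventWeight (z := Complex.I) hφ one_pos
  have key : ∀ f, (∫ x, φ x * resolventWeight φ Complex.I 1 x ∂(E.meas f)) =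
        (∫ x, φ x * resolventWeight φ Complex.I 1 x ∂(F.meas f)) ∧
      (∫ x, resolventWeight φ Complex.I 1 x ∂(E.meas f)) =
        ∫ x, resolventWeight φ Complex.I 1 x ∂(F.meas f) := fun f => by
    have h1 := congrArg (fun A : H →L[ℂ] H => ⟪f, A f⟫_ℂ) h
    simp only [resolvent, Complex.I_re, Complex.I_im, sub_zero, Complex.ofReal_one, one_mul,
      add_apply, smul_apply, inner_add_right, inner_smul_right,
      inner_bounded_self _ hP, inner_bounded_self _ hQ] at h1
    exact ⟨by simpa using congrArg Complex.re h1, by simpa using congrArg Complex.im h1⟩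
  refine ⟨E.bounded_eq_of_forall_inner hP fun f => ?_,
    E.bounded_eq_of_forall_inner hQ fun f => ?_⟩
  · rw [inner_bounded_self F hP, (key f).1]
  · rw [inner_bounded_self F hQ, (key f).2]

/-- A spectral family is determined by its operator `∫ t dE(t)`. -/
lemma eq_of_op_eq (h : E.op (fun t => t) = F.op fun t => t) : E = F := by
  have hid : Measurable fun t : ℝ => t := measurable_id
  have hI : ∀ x : ℝ, 1 ≤ ‖(x : ℂ) - Complex.I‖ := fun x => by
    simpa using abs_im_le_norm_ofReal_sub x Complex.I
  have hE := E.isResolvent_op hid one_pos fun f => ae_of_all _ hI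
  have hF := F.isResolvent_op hid one_pos fun f => ae_of_all _ hI
  rw [← h] at hF
  obtain ⟨hP, hQ⟩ := bounded_eq_of_resolvent_eq hid (hE.unique hF)
  have hw : Continuous (resolventWeight (fun t => t) Complex.I 1) := by
    refine Continuous.inv₀ (by fun_prop) fun x => ?_
    exact (lt_max_of_lt_right (by norm_num)).ne'
  obtain ⟨C, hC⟩ := (isBoundedMeasurable_sub_mul_resolventWeight (z := Complex.I) hid
    one_pos).bounded
  obtain ⟨D, hD⟩ := (isBoundedMeasurable_resolventWeight (z := Complex.I) hid one_pos).bounded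
  let p : BoundedContinuousFunction ℝ ℝ := BoundedContinuousFunction.ofNormedAddCommGroup
    (fun x => x * resolventWeight (fun t => t) Complex.I 1 x) (continuous_id.mul hw) C
    (by simpa using hC)
  let q : BoundedContinuousFunction ℝ ℝ := BoundedContinuousFunction.ofNormedAddCommGroup
    (resolventWeight (fun t => t) Complex.I 1) hw D hD
  refine ext_of_meas fun f => ?_
  -- Stone–Weierstrass: a point-separating algebra of bounded continuous functions determines a
  -- finite measure. Here `q = 1/(1 + x²)` and `p = x q` separate points, since `q > 0` and `p / q =
  -- x`.
  refine ext_of_forall_mem_subalgebra_integral_eq_of_polish (𝕜 := ℝ)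
    (A := agreementAlgebra E F) ?_ fun g hg => ?_
  · intro x y hxy
    by_contra! hsep
    have h1 : p x = p y := hsep p ⟨_, ⟨p, hP, rfl⟩, rfl⟩
    have h2 : q x = q y := hsep q ⟨_, ⟨q, hQ, rfl⟩, rfl⟩
    change x * q x = y * q y at h1
    rw [h2] at h1
    have hq : 0 < q y :=
      resolventWeight_pos (φ := fun t => t) (z := Complex.I) one_pos y
    exact hxy (mul_right_cancel₀ hq.ne' h1)
  · have hb := isBoundedMeasurable_coe g
    have h1 := E.inner_bounded_self hb f
    rw [show E.bounded g = F.bounded g from hg, inner_bounded_self F hb] at h1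
    exact (Complex.ofReal_injective h1).symm

end SpectralFamily

/-! ### The spectral family of the inverse of a bounded operator -/

section BoundedOperator

variable {R : H →L[ℂ] H} (hR : IsSelfAdjoint R)

lemma cfcHom_symm (k : C(spectrum ℝ R, ℝ)) (g f : H) :
    ⟪cfcHom hR k g, f⟫_ℂ = ⟪g, cfcHom hR k f⟫_ℂ := by
  have h := cfcHom_predicate hR k
  rw [ContinuousLinearMap.isSelfAdjoint_iff'] at h
  conv_rhs => rw [← h]
  rw [ContinuousLinearMap.adjoint_inner_right]

lemma re_inner_cfcHom_nonneg {k : C(spectrum ℝ R, ℝ)} (hk : 0 ≤ k) (f : H) :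
    0 ≤ (⟪f, cfcHom hR k f⟫_ℂ).re := by
  have h := (cfcHom_nonneg_iff hR).2 hk
  rw [ContinuousLinearMap.nonneg_iff_isPositive] at h
  exact h.re_inner_nonneg_right f

lemma inner_cfcHom_mul_self (k : C(spectrum ℝ R, ℝ)) (f : H) :
    (⟪f, cfcHom hR (k * k) f⟫_ℂ).re = ‖cfcHom hR k f‖ ^ 2 := by
  rw [map_mul, mul_apply_eq_comp, ← cfcHom_symm, inner_self_eq_norm_sq_to_K]
  norm_cast

/-- `‖k(R)f‖²` is the quadratic form of `k²(R)`, and the functional calculus preserves order. -/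
lemma norm_cfcHom_apply_le {k l : C(spectrum ℝ R, ℝ)} (h : ∀ x, |k x| ≤ |l x|) (f : H) :
    ‖cfcHom hR k f‖ ≤ ‖cfcHom hR l f‖ := by
  refine (sq_le_sq₀ (norm_nonneg _) (norm_nonneg _)).1 ?_
  rw [← inner_cfcHom_mul_self, ← inner_cfcHom_mul_self, ← sub_nonneg, ← Complex.sub_re,
    ← inner_sub_right, ← sub_apply, ← map_sub]
  have h' : 0 ≤ l * l - k * k := sub_nonneg.2 fun x => by
    change k x * k x ≤ l x * l x
    simpa only [pow_two] using sq_le_sq.2 (h x)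
  exact re_inner_cfcHom_nonneg hR h' f

lemma norm_cfcHom_apply_le_const {k : C(spectrum ℝ R, ℝ)} {c : ℝ} (h : ∀ x, |k x| ≤ c) (f : H)
    (hc : 0 ≤ c) : ‖cfcHom hR k f‖ ≤ c * ‖f‖ := by
  have h1 := norm_cfcHom_apply_le hR (l := algebraMap ℝ C(spectrum ℝ R, ℝ) c)
    (fun x => by simpa [abs_of_nonneg hc] using h x) f
  rw [AlgHomClass.commutes, Algebra.algebraMap_eq_smul_one, smul_apply, one_apply_eq_self,
    norm_smul, Real.norm_of_nonneg hc] at h1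
  exact h1

/-- Riesz–Markov–Kakutani for the positive functional `k ↦ (k(R)f, f)`; the spectrum is compact, so
every continuous function on it has compact support. -/
lemma exists_measure_cfcHom (f : H) : ∃ ν : Measure (spectrum ℝ R), IsFiniteMeasure ν ∧
    ∀ k : C(spectrum ℝ R, ℝ), ∫ x, k x ∂ν = (⟪f, cfcHom hR k f⟫_ℂ).re := by
  let Λ : CompactlySupportedContinuousMap (spectrum ℝ R) ℝ →ₚ[ℝ] ℝ :=
    { toFun := fun k => (⟪f, cfcHom hR k.toContinuousMap f⟫_ℂ).re
      map_add' := fun k l => by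
        rw [← Complex.add_re, ← inner_add_right, ← add_apply, ← map_add]; rfl
      map_smul' := fun c k => by
        have h : (c • k).toContinuousMap = c • k.toContinuousMap := rfl
        rw [h, map_smul, smul_apply, inner_smul_right_eq_smul]
        simp
      monotone' := fun k l hkl => by
        change (⟪f, cfcHom hR k.toContinuousMap f⟫_ℂ).re ≤
          (⟪f, cfcHom hR l.toContinuousMap f⟫_ℂ).re
        rw [← sub_nonneg, ← Complex.sub_re, ← inner_sub_right, ← sub_apply, ← map_sub]
        have h : 0 ≤ l.toContinuousMap - k.toContinuousMap := sub_nonneg.2 fun x => hkl x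
        exact re_inner_cfcHom_nonneg hR h f }
  refine ⟨RealRMK.rieszMeasure Λ, inferInstance, fun k => ?_⟩
  exact RealRMK.integral_rieszMeasure Λ ⟨k, HasCompactSupport.of_compactSpace _⟩

/-- The measure on the spectrum which represents `k ↦ (k(R) f, f)`. -/
def spectralMeasure (f : H) : Measure (spectrum ℝ R) := (exists_measure_cfcHom hR f).choose

instance (f : H) : IsFiniteMeasure (spectralMeasure hR f) :=
  (exists_measure_cfcHom hR f).choose_spec.1

lemma integral_spectralMeasure (f : H) (k : C(spectrum ℝ R, ℝ)) :
    ∫ x, k x ∂(spectralMeasure hR f) = (⟪f, cfcHom hR k f⟫_ℂ).re :=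
  (exists_measure_cfcHom hR f).choose_spec.2 k

lemma integral_sq_spectralMeasure (f : H) (k : C(spectrum ℝ R, ℝ)) :
    ∫ x, k x ^ 2 ∂(spectralMeasure hR f) = ‖cfcHom hR k f‖ ^ 2 := by
  rw [← inner_cfcHom_mul_self, ← integral_spectralMeasure]
  simp [pow_two]

variable (R) in
/-- The function `x ↦ (1 - t x)⁺` on the spectrum of `R`. -/
def posPartOneSub (t : ℝ) : C(spectrum ℝ R, ℝ) :=
  ⟨fun x => max (1 - t * x) 0, by fun_prop⟩

/-- The spectral subspace of `R` for the set of all `x` with `t x ≥ 1`. -/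
def spectralSubspace (t : ℝ) : Submodule ℂ H :=
  -- The continuous function `(1 - tx)⁺` vanishes exactly where `tx ≥ 1`, so its kernel gives the
  -- spectral subspace without a Borel calculus for `R`.
  LinearMap.ker (cfcHom hR (posPartOneSub R t)).toLinearMap

instance (t : ℝ) : CompleteSpace (spectralSubspace hR t) :=
  (cfcHom hR (posPartOneSub R t)).isClosed_ker.completeSpace_coe

lemma mem_spectralSubspace {t : ℝ} {f : H} :
    f ∈ spectralSubspace hR t ↔ cfcHom hR (posPartOneSub R t) f = 0 := Iff.rfl

/-- For `x ≥ 0` the function `(1 - tx)⁺` decreases in `t`, so its kernel grows. -/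
lemma spectralSubspace_mono (h0 : spectrum ℝ R ⊆ Icc 0 1) : Monotone (spectralSubspace hR) := by
  intro s t hst f hf
  rw [mem_spectralSubspace] at hf ⊢
  rw [← norm_le_zero_iff, ← norm_zero (E := H), ← hf]
  refine norm_cfcHom_apply_le hR (fun x => ?_) f
  have hx := (h0 x.2).1
  simp only [posPartOneSub, ContinuousMap.coe_mk]
  rw [abs_of_nonneg (le_max_right _ _), abs_of_nonneg (le_max_right _ _)]
  exact max_le_max_right _ (sub_le_sub_left (mul_le_mul_of_nonneg_right hst hx) _)

variable (R) in
/-- Continuous functions which decrease to the indicator function of `{x | t x ≥ 1}`. -/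
def approxIndicator (t : ℝ) (n : ℕ) : C(spectrum ℝ R, ℝ) :=
  ⟨fun x => max (1 - n * posPartOneSub R t x) 0, by fun_prop⟩

omit [CompleteSpace H] in
lemma posPartOneSub_nonneg (t : ℝ) (x : spectrum ℝ R) : 0 ≤ posPartOneSub R t x :=
  le_max_right _ _

omit [CompleteSpace H] in
lemma approxIndicator_nonneg (t : ℝ) (n : ℕ) (x : spectrum ℝ R) : 0 ≤ approxIndicator R t n x :=
  le_max_right _ _

omit [CompleteSpace H] in
lemma approxIndicator_le_one (t : ℝ) (n : ℕ) (x : spectrum ℝ R) : approxIndicator R t n x ≤ 1 :=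
  max_le (sub_le_self _ (mul_nonneg n.cast_nonneg (posPartOneSub_nonneg t x))) zero_le_one

lemma cfcHom_approxIndicator_of_mem {t : ℝ} {f : H} (hf : f ∈ spectralSubspace hR t) (n : ℕ) :
    cfcHom hR (approxIndicator R t n) f = f := by
  have h1 : cfcHom hR (1 - approxIndicator R t n) f = 0 := by
    rw [← norm_le_zero_iff]
    -- `0 ≤ 1 - (1 - np)⁺ ≤ np` with `p = (1 - tx)⁺`, and `p(R)` kills `f`.
    refine (norm_cfcHom_apply_le hR (l := (n : ℝ) • posPartOneSub R t) (fun x => ?_) f).trans ?_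
    · have h2 := approxIndicator_le_one t n x
      have h3 : 1 - n * posPartOneSub R t x ≤ approxIndicator R t n x := le_max_left _ _
      simp only [ContinuousMap.sub_apply, ContinuousMap.one_apply, ContinuousMap.smul_apply,
        smul_eq_mul]
      rw [abs_of_nonneg (by linarith),
        abs_of_nonneg (mul_nonneg n.cast_nonneg (posPartOneSub_nonneg t x))]
      linarith
    · rw [map_smul, smul_apply, (mem_spectralSubspace hR).1 hf, smul_zero, norm_zero]
  rw [map_sub, map_one, sub_apply, one_apply_eq_self, sub_eq_zero] at h1
  exact h1.symm

lemma norm_cfcHom_approxIndicator_mul_le (t : ℝ) {n : ℕ} (hn : 0 < n) (f : H) :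
    ‖cfcHom hR (approxIndicator R t n) (cfcHom hR (posPartOneSub R t) f)‖ ≤
      1 / (n : ℝ) * ‖f‖ := by
  rw [← mul_apply_eq_comp, ← map_mul]
  refine norm_cfcHom_apply_le_const hR (fun x => ?_) f (by positivity)
  have h1 := approxIndicator_le_one t n x
  have h2 := approxIndicator_nonneg t n x
  have h3 := posPartOneSub_nonneg t x
  rw [ContinuousMap.mul_apply, abs_of_nonneg (mul_nonneg h2 h3),
    le_div_iff₀ (by exact_mod_cast hn)]
  rcases le_total (1 - n * posPartOneSub R t x) 0 with h | h
  · rw [show approxIndicator R t n x = 0 from max_eq_right h]; simp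
  · rw [show approxIndicator R t n x = 1 - n * posPartOneSub R t x from max_eq_left h]
    -- `np(1 - np) ≤ 1/4`.
    nlinarith [sq_nonneg (n * posPartOneSub R t x - 1 / 2)]

/-- With `p = (1 - tx)⁺`, the approximants fix `ker p(R)`. On its orthogonal complement, the closure
of the range of `p(R)`, they tend to `0`: they are contractions, and on the range itself they are
`O(1/n)`. -/
lemma tendsto_cfcHom_approxIndicator (t : ℝ) (f : H) :
    Tendsto (fun n => cfcHom hR (approxIndicator R t n) f) atTop
      (𝓝 ((spectralSubspace hR t).starProjection f)) := by
  set e := (spectralSubspace hR t).starProjection f with he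
  have he' : e ∈ spectralSubspace hR t := Submodule.starProjection_apply_mem _ _
  have hf2 : f - e ∈ (spectralSubspace hR t)ᗮ := Submodule.sub_starProjection_mem_orthogonal _
  have hcl : f - e ∈ closure (range (cfcHom hR (posPartOneSub R t))) := by
    have h := ContinuousLinearMap.orthogonal_ker (cfcHom hR (posPartOneSub R t))
    have h' := cfcHom_predicate hR (posPartOneSub R t)
    rw [ContinuousLinearMap.isSelfAdjoint_iff'] at h'
    rw [h'] at h
    have := h.le hf2
    rw [← SetLike.mem_coe, Submodule.topologicalClosure_coe, LinearMap.coe_range] at this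
    exact this
  have key : Tendsto (fun n => cfcHom hR (approxIndicator R t n) (f - e)) atTop (𝓝 0) := by
    rw [Metric.tendsto_atTop]
    intro ε hε
    obtain ⟨_, ⟨g, rfl⟩, hg⟩ := Metric.mem_closure_iff.1 hcl (ε / 2) (by positivity)
    have h0 : Tendsto (fun n : ℕ => 1 / (n : ℝ) * ‖g‖) atTop (𝓝 0) := by
      simpa using tendsto_one_div_atTop_nhds_zero_nat.mul_const ‖g‖
    obtain ⟨N, hN⟩ := eventually_atTop.1 (h0.eventually_lt_const (half_pos hε))
    refine ⟨N + 1, fun n hn => ?_⟩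
    have h1 := norm_cfcHom_approxIndicator_mul_le hR t (n := n) (by omega) g
    have h2 := norm_cfcHom_apply_le_const hR (k := approxIndicator R t n) (c := 1)
      (fun x => by
        rw [abs_of_nonneg (approxIndicator_nonneg t n x)]; exact approxIndicator_le_one t n x)
      (f - e - cfcHom hR (posPartOneSub R t) g) zero_le_one
    rw [dist_eq_norm] at hg
    rw [dist_zero_right]
    have h3 : cfcHom hR (approxIndicator R t n) (f - e) =
        cfcHom hR (approxIndicator R t n) (f - e - cfcHom hR (posPartOneSub R t) g) +
        cfcHom hR (approxIndicator R t n) (cfcHom hR (posPartOneSub R t) g) := by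
      rw [← map_add, sub_add_cancel]
    rw [h3]
    refine (norm_add_le _ _).trans_lt ?_
    linarith [hN n (by omega)]
  have h4 := key.add_const e
  rw [zero_add] at h4
  refine h4.congr fun n => ?_
  rw [map_sub, cfcHom_approxIndicator_of_mem hR he', sub_add_cancel]

omit [CompleteSpace H] in
lemma tendsto_approxIndicator (t : ℝ) (x : spectrum ℝ R) :
    Tendsto (fun n => approxIndicator R t n x) atTop
      (𝓝 ({x : spectrum ℝ R | 1 ≤ t * x}.indicator (fun _ => 1) x)) := by
  by_cases hx : 1 ≤ t * x
  · rw [indicator_of_mem (show x ∈ {x : spectrum ℝ R | 1 ≤ t * x} from hx)]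
    refine tendsto_const_nhds.congr fun n => ?_
    simp [approxIndicator, posPartOneSub, hx]
  · rw [indicator_of_notMem (show x ∉ {x : spectrum ℝ R | 1 ≤ t * x} from hx)]
    have hp : 0 < posPartOneSub R t x := lt_max_of_lt_left (by linarith)
    obtain ⟨N, hN⟩ := exists_nat_ge (1 / posPartOneSub R t x)
    refine tendsto_const_nhds.congr' ?_
    filter_upwards [eventually_ge_atTop N] with n hn
    refine (max_eq_right ?_).symm
    have h1 : 1 / posPartOneSub R t x ≤ n := hN.trans (by exact_mod_cast hn)
    rw [div_le_iff₀ hp] at h1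
    linarith

omit [CompleteSpace H] in
lemma measurableSet_one_le_mul (t : ℝ) : MeasurableSet {x : spectrum ℝ R | 1 ≤ t * x} :=
  measurableSet_le measurable_const (measurable_subtype_coe.const_mul t)

/-- Links the projections to the representing measure; the properties of the spectral family are
read off from the sets `{tx ≥ 1}`. -/
lemma norm_sq_starProjection_spectralSubspace (t : ℝ) (f : H) :
    ‖(spectralSubspace hR t).starProjection f‖ ^ 2 =
      (spectralMeasure hR f).real {x | 1 ≤ t * x} := by
  refine tendsto_nhds_unique ((tendsto_cfcHom_approxIndicator hR t f).norm.pow 2) ?_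
  simp only [← integral_sq_spectralMeasure]
  have h1 : (spectralMeasure hR f).real {x | 1 ≤ t * x} = ∫ x,
      ({x : spectrum ℝ R | 1 ≤ t * x}.indicator (fun _ => (1 : ℝ)) x) ^ 2
        ∂(spectralMeasure hR f) := by
    rw [← integral_indicator_one (measurableSet_one_le_mul t)]
    refine integral_congr_ae (ae_of_all _ fun x => ?_)
    by_cases hx : x ∈ {x : spectrum ℝ R | 1 ≤ t * x} <;> simp [indicator]
  rw [h1]
  refine tendsto_integral_of_dominated_convergence (fun _ => 1)
    (fun n => (by fun_prop : Continuous fun x =>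
      approxIndicator R t n x ^ 2).aestronglyMeasurable) (integrable_const _)
    (fun n => ae_of_all _ fun x => ?_)
    (ae_of_all _ fun x => (tendsto_approxIndicator t x).pow 2)
  rw [Real.norm_of_nonneg (sq_nonneg _)]
  exact pow_le_one₀ (approxIndicator_nonneg t n x) (approxIndicator_le_one t n x)

end BoundedOperator

/-! ### Axioms of the spectral family of `R⁻¹` -/

section BoundedOperator

variable {R : H →L[ℂ] H} (hR : IsSelfAdjoint R)

lemma norm_sq_apply_eq_integral (f : H) :
    ‖R f‖ ^ 2 = ∫ x, (x : ℝ) ^ 2 ∂(spectralMeasure hR f) := by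
  have h := integral_sq_spectralMeasure hR f (.restrict (spectrum ℝ R) (.id ℝ))
  rw [cfcHom_id hR] at h
  exact h.symm

lemma inner_apply_eq_integral (f : H) :
    ⟪f, R f⟫_ℂ = ((∫ x, (x : ℝ) ∂(spectralMeasure hR f) : ℝ) : ℂ) := by
  have h := integral_spectralMeasure hR f (.restrict (spectrum ℝ R) (.id ℝ))
  rw [cfcHom_id hR] at h
  apply Complex.ext
  · rw [Complex.ofReal_re]; exact h.symm
  · have h1 := cfcHom_symm hR (.restrict (spectrum ℝ R) (.id ℝ)) f f
    rw [cfcHom_id hR, ← inner_conj_symm] at h1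
    rw [Complex.ofReal_im]
    exact Complex.conj_eq_iff_im.1 h1

lemma starProjection_eq_zero_of_lt_one (h0 : spectrum ℝ R ⊆ Icc 0 1) {t : ℝ} (ht : t < 1) (f : H) :
    (spectralSubspace hR t).starProjection f = 0 := by
  rw [← norm_eq_zero, ← sq_eq_zero_iff, norm_sq_starProjection_spectralSubspace]
  convert measureReal_empty
  refine eq_empty_of_forall_notMem fun x (hx : 1 ≤ t * x) => ?_
  have h1 := h0 x.2
  have hx1 : (x : ℝ) = 1 := le_antisymm h1.2 (by nlinarith [h1.1])
  rw [hx1] at hx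
  linarith

/-- For a vector orthogonal to all the subspaces, the sets `{tx ≥ 1}` are null for every `t`, so its
measure sits at `0`. Then `R f = 0` and `f = 0`. -/
lemma iSup_spectralSubspace_dense (h0 : spectrum ℝ R ⊆ Icc 0 1) (hinj : ∀ f, R f = 0 → f = 0) :
    (⨆ t, spectralSubspace hR t).topologicalClosure = ⊤ := by
  rw [Submodule.topologicalClosure_eq_top_iff, Submodule.eq_bot_iff]
  intro f hf
  have h1 : ∀ t, spectralMeasure hR f {x : spectrum ℝ R | 1 ≤ t * (x : ℝ)} = 0 := fun t => by
    have h2 : (spectralSubspace hR t).starProjection f = 0 := by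
      rw [Submodule.starProjection_apply_eq_zero_iff]
      exact Submodule.orthogonal_le (le_iSup _ t) hf
    have h3 := norm_sq_starProjection_spectralSubspace hR t f
    rw [h2, norm_zero, zero_pow two_ne_zero] at h3
    exact (measureReal_eq_zero_iff).1 h3.symm
  have h4 : ∀ᵐ x : spectrum ℝ R ∂(spectralMeasure hR f), (x : ℝ) = 0 := by
    have h5 : ∀ᵐ x : spectrum ℝ R ∂(spectralMeasure hR f), ∀ n : ℕ, ¬ (1 ≤ (n : ℝ) * x) :=
      ae_all_iff.2 fun n => by rw [ae_iff]; simpa using h1 n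
    filter_upwards [h5] with x hx
    by_contra hne
    have hpos : 0 < (x : ℝ) := lt_of_le_of_ne (h0 x.2).1 (Ne.symm hne)
    obtain ⟨n, hn⟩ := exists_nat_ge (1 / (x : ℝ))
    exact hx n ((div_le_iff₀ hpos).1 hn)
  refine hinj f ?_
  rw [← norm_eq_zero, ← sq_eq_zero_iff, norm_sq_apply_eq_integral hR]
  refine integral_eq_zero_of_ae ?_
  filter_upwards [h4] with x hx
  simp [hx]

/-- For nested projections `‖E(u)f - E(t)f‖²` is a difference of masses. As `u ↓ t` the indicators
converge pointwise: `1 ≤ tx` persists for `u ≥ t`, and `tx < 1` is an open condition. -/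
lemma continuousWithinAt_starProjection_spectralSubspace (h0 : spectrum ℝ R ⊆ Icc 0 1) (f : H)
    (t : ℝ) :
    ContinuousWithinAt (fun u => (spectralSubspace hR u).starProjection f) (Ici t) t := by
  have hm : Tendsto (fun u => (spectralMeasure hR f).real {x : spectrum ℝ R | 1 ≤ u * (x : ℝ)})
      (𝓝[Ici t] t) (𝓝 ((spectralMeasure hR f).real {x : spectrum ℝ R | 1 ≤ t * (x : ℝ)})) := by
    simp only [← integral_indicator_one (measurableSet_one_le_mul _)]
    refine tendsto_integral_filter_of_dominated_convergence (fun _ => 1)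
      (Eventually.of_forall fun u =>
        (measurable_one.indicator (measurableSet_one_le_mul u)).aestronglyMeasurable)
      (Eventually.of_forall fun u => ae_of_all _ fun x => ?_) (integrable_const _)
      (ae_of_all _ fun x => ?_)
    · refine (norm_indicator_le_norm_self _ _).trans ?_
      simp
    · refine tendsto_const_nhds.congr' ?_
      by_cases hx : 1 ≤ t * x
      · filter_upwards [self_mem_nhdsWithin] with u hu
        have hu' : 1 ≤ u * x := hx.trans (mul_le_mul_of_nonneg_right hu (h0 x.2).1)
        simp [indicator, hx, hu']
      · have h1 : Tendsto (fun u : ℝ => u * (x : ℝ)) (𝓝[Ici t] t) (𝓝 (t * x)) :=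
          ((continuous_id.mul continuous_const).tendsto t).mono_left nhdsWithin_le_nhds
        filter_upwards [h1.eventually_lt_const (not_le.1 hx)] with u hu
        simp [indicator, hx, not_le.2 hu]
  rw [ContinuousWithinAt, tendsto_iff_norm_sub_tendsto_zero]
  have h2 : Tendsto (fun u => ‖(spectralSubspace hR u).starProjection f -
      (spectralSubspace hR t).starProjection f‖ ^ 2) (𝓝[Ici t] t) (𝓝 0) := by
    have h3 := hm.sub_const ((spectralMeasure hR f).real {x : spectrum ℝ R | 1 ≤ t * (x : ℝ)})
    rw [sub_self] at h3
    refine h3.congr' ?_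
    filter_upwards [self_mem_nhdsWithin] with u hu
    rw [← norm_sq_starProjection_spectralSubspace, ← norm_sq_starProjection_spectralSubspace]
    have hle := spectralSubspace_mono hR h0 hu
    have h4 : (spectralSubspace hR t).starProjection
        ((spectralSubspace hR u).starProjection f) = (spectralSubspace hR t).starProjection f := by
      rw [← ContinuousLinearMap.comp_apply,
        Submodule.starProjection_comp_starProjection_of_le hle]
    have h5 := Submodule.norm_sq_eq_add_norm_sq_starProjection
      ((spectralSubspace hR u).starProjection f) (spectralSubspace hR t)
    rw [h4, Submodule.starProjection_orthogonal'] at h5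
    simp only [sub_apply, one_apply_eq_self, h4] at h5
    linarith
  have := h2.sqrt
  simpa [Real.sqrt_sq] using this

/-- The spectral family `E(t) = 1_{[1/t, ∞)}(R)` of the inverse of `R`. -/
def spectralFamilyInv (h0 : spectrum ℝ R ⊆ Icc 0 1) (hinj : ∀ f, R f = 0 → f = 0) :
    SpectralFamily H where
  proj t := (spectralSubspace hR t).starProjection
  isStarProjection t := isStarProjection_starProjection
  proj_comp s t hst :=
    Submodule.starProjection_comp_starProjection_of_le (spectralSubspace_mono hR h0 hst)
  right_continuous f t := continuousWithinAt_starProjection_spectralSubspace hR h0 f t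
  tendsto_atBot f := by
    refine tendsto_const_nhds.congr' ?_
    filter_upwards [Iio_mem_atBot (1 : ℝ)] with t ht
    exact (starProjection_eq_zero_of_lt_one hR h0 ht f).symm
  tendsto_atTop f := Submodule.starProjection_tendsto_self _ (spectralSubspace_mono hR h0) f
    (iSup_spectralSubspace_dense hR h0 hinj).ge

/-- The restriction to `x > 0` matters because `0⁻¹ = 0` would send mass at `0` into the half-lines
`(-∞, t]` with `t ≥ 0`. -/
lemma meas_spectralFamilyInv (h0 : spectrum ℝ R ⊆ Icc 0 1) (hinj : ∀ f, R f = 0 → f = 0) (f : H) :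
    (spectralFamilyInv hR h0 hinj).meas f =
      ((spectralMeasure hR f).restrict {x : spectrum ℝ R | 0 < (x : ℝ)}).map
        fun x : spectrum ℝ R => (x : ℝ)⁻¹ := by
  refine Measure.ext_of_Iic _ _ fun t => ?_
  have hm : Measurable fun x : spectrum ℝ R => (x : ℝ)⁻¹ := measurable_subtype_coe.inv
  rw [SpectralFamily.meas_Iic, SpectralFamily.dist_eq_norm_sq, Measure.map_apply hm
    measurableSet_Iic, Measure.restrict_apply (hm measurableSet_Iic)]
  change ENNReal.ofReal (‖(spectralSubspace hR t).starProjection f‖ ^ 2) = _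
  rw [norm_sq_starProjection_spectralSubspace, ofReal_measureReal]
  congr 1
  ext x
  have hx := (h0 x.2).1
  simp only [mem_inter_iff, mem_preimage, mem_Iic, mem_ofPred_eq]
  constructor
  · intro h
    have hpos : 0 < (x : ℝ) := lt_of_le_of_ne hx fun h' => by
      rw [← h'] at h; norm_num at h
    exact ⟨(inv_le_iff_one_le_mul₀ hpos).2 h, hpos⟩
  · rintro ⟨h, hpos⟩
    exact (inv_le_iff_one_le_mul₀ hpos).1 h

lemma one_le_ae_meas_spectralFamilyInv (h0 : spectrum ℝ R ⊆ Icc 0 1)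
    (hinj : ∀ f, R f = 0 → f = 0) (f : H) :
    ∀ᵐ x ∂((spectralFamilyInv hR h0 hinj).meas f), 1 ≤ x := by
  have hm : Measurable fun x : spectrum ℝ R => (x : ℝ)⁻¹ := measurable_subtype_coe.inv
  rw [meas_spectralFamilyInv, ae_map_iff hm.aemeasurable measurableSet_Ici,
    ae_restrict_iff' (measurableSet_lt measurable_const measurable_subtype_coe)]
  exact ae_of_all _ fun x hx => (one_le_inv₀ hx).2 (h0 x.2).2

/-- The resolvent at `0` is `∫ t⁻¹ dE`. Pulled back under `t = x⁻¹`, its quadratic form becomes `∫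
x`, which is that of `R`. -/
lemma isResolvent_spectralFamilyInv (h0 : spectrum ℝ R ⊆ Icc 0 1) (hinj : ∀ f, R f = 0 → f = 0) :
    IsResolvent ((spectralFamilyInv hR h0 hinj).op fun t => t) 0 R := by
  set E := spectralFamilyInv hR h0 hinj with hE
  have hid : Measurable fun t : ℝ => t := measurable_id
  have h := E.isResolvent_op (z := 0) hid one_pos fun f => by
    filter_upwards [one_le_ae_meas_spectralFamilyInv hR h0 hinj f] with x hx
    simpa using hx.trans (le_abs_self x)
  have hP := SpectralFamily.isBoundedMeasurable_sub_mul_resolventWeight (z := 0) hid one_pos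
  have hRe : E.resolvent (fun t => t) 0 1 = R := by
    rw [SpectralFamily.resolvent]
    simp only [Complex.zero_im, Complex.ofReal_zero, zero_mul, zero_smul, add_zero]
    refine E.bounded_eq_of_forall_inner hP fun f => ?_
    rw [inner_apply_eq_integral hR f]
    congr 1
    have hm : Measurable fun x : spectrum ℝ R => (x : ℝ)⁻¹ := measurable_subtype_coe.inv
    rw [hE, meas_spectralFamilyInv, integral_map hm.aemeasurable
      hP.measurable.aestronglyMeasurable]
    have hS : MeasurableSet {x : spectrum ℝ R | 0 < (x : ℝ)} :=
      measurableSet_lt measurable_const measurable_subtype_coe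
    rw [← integral_indicator hS]
    refine integral_congr_ae (ae_of_all _ fun x => ?_)
    by_cases hx : 0 < (x : ℝ)
    · simp only [indicator, mem_ofPred_eq, hx, if_true]
      have h1 : 1 ≤ (x : ℝ)⁻¹ := (one_le_inv₀ hx).2 (h0 x.2).2
      have h2 : (1 : ℝ) ^ 2 ≤ ((x : ℝ)⁻¹ - (0 : ℂ).re) ^ 2 + (0 : ℂ).im ^ 2 := by
        simp only [Complex.zero_re, Complex.zero_im]
        nlinarith
      rw [SpectralFamily.resolventWeight, max_eq_left h2]
      simp only [Complex.zero_re, Complex.zero_im]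
      field_simp
      simp
    -- The discarded point contributes nothing, because the integrand `x` vanishes there.
    · have hx0 : (x : ℝ) = 0 := le_antisymm (not_lt.1 hx) (h0 x.2).1
      simp [indicator, hx0]
  rwa [hRe] at h

end BoundedOperator

/-! ### Self-adjoint operators with spectrum in `[1, ∞)` -/

section SelfAdjoint

variable {T : H →ₗ.[ℂ] H}

lemma isFormalAdjoint_of_isSelfAdjoint (hT : IsSelfAdjoint T) : T.IsFormalAdjoint T := by
  have h := LinearPMap.adjoint_isFormalAdjoint hT.dense_domain
  rwa [LinearPMap.isSelfAdjoint_def.1 hT] at h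

lemma IsResolvent.isSelfAdjoint {R : H →L[ℂ] H} (hT : T.IsFormalAdjoint T)
    (hR : IsResolvent T 0 R) : IsSelfAdjoint R := by
  rw [ContinuousLinearMap.isSelfAdjoint_iff']
  refine ContinuousLinearMap.ext fun f => ext_inner_right ℂ fun g => ?_
  obtain ⟨hf, hf'⟩ := hR.right_inv f
  obtain ⟨hg, hg'⟩ := hR.right_inv g
  rw [zero_smul, sub_zero] at hf' hg'
  rw [ContinuousLinearMap.adjoint_inner_left]
  have h := hT ⟨R f, hf⟩ ⟨R g, hg⟩
  rwa [hf', hg'] at h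

omit [CompleteSpace H] in
lemma IsResolvent.eq_zero_of_apply_eq_zero {R : H →L[ℂ] H} (hR : IsResolvent T 0 R) {f : H}
    (hf : R f = 0) : f = 0 := by
  obtain ⟨h, h'⟩ := hR.right_inv f
  rw [zero_smul, sub_zero] at h'
  rw [← h']
  have : (⟨R f, h⟩ : T.domain) = 0 := Subtype.ext hf
  rw [this, LinearPMap.map_zero]

omit [CompleteSpace H] in
/-- If `T - z` has a bounded inverse, then so has `T⁻¹ - z⁻¹`. -/
lemma IsResolvent.isUnit_algebraMap_inv_sub {R S : H →L[ℂ] H} {z : ℂ} (hz : z ≠ 0)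
    (hR : IsResolvent T 0 R) (hS : IsResolvent T z S) :
    IsUnit (algebraMap ℂ (H →L[ℂ] H) z⁻¹ - R) := by
  have h1 : ∀ f, R (f + z • S f) = S f := fun f => by
    obtain ⟨h, h'⟩ := hS.right_inv f
    have := hR.left_inv ⟨S f, h⟩
    rwa [zero_smul, sub_zero, sub_eq_iff_eq_add.1 h'] at this
  have h2 : ∀ f, S (f - z • R f) = R f := fun f => by
    obtain ⟨h, h'⟩ := hR.right_inv f
    have := hS.left_inv ⟨R f, h⟩
    rw [zero_smul, sub_zero] at h'
    rwa [h'] at this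
  -- The witness comes from `1/(1/z - 1/t) = zt/(t - z) = z(1 + z/(t - z))`.
  refine isUnit_iff_exists.2 ⟨z • (1 + z • S), ?_, ?_⟩
  · ext f
    have := h1 f
    simp only [mul_apply_eq_comp, sub_apply, smul_apply, add_apply, one_apply_eq_self,
      Algebra.algebraMap_eq_smul_one, map_smul, this]
    rw [smul_sub, smul_smul, mul_inv_cancel₀ hz]
    module
  · ext f
    have := h2 (z⁻¹ • f)
    simp only [mul_apply_eq_comp, sub_apply, smul_apply, add_apply, one_apply_eq_self,
      Algebra.algebraMap_eq_smul_one]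
    rw [map_smul, smul_smul, mul_inv_cancel₀ hz, one_smul] at this
    rw [this, smul_smul, mul_inv_cancel₀ hz, one_smul, sub_add_cancel, smul_smul,
      mul_inv_cancel₀ hz, one_smul]

omit [CompleteSpace H] in
-- A real `x ≠ 0` outside `[0, 1]` has `x⁻¹` outside `[1, ∞)`, so `T - x⁻¹` has a bounded inverse
-- and hence so does `x - R`.
lemma IsResolvent.spectrum_subset {R : H →L[ℂ] H} (hT1 : opSpectrum T ⊆ Complex.ofReal '' Ici 1)
    (hR : IsResolvent T 0 R) : spectrum ℝ R ⊆ Icc 0 1 := by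
  intro x hx
  by_contra hx'
  have hx0 : x ≠ 0 := by rintro rfl; exact hx' ⟨le_rfl, zero_le_one⟩
  have hz : ((x⁻¹ : ℝ) : ℂ) ∉ opSpectrum T := fun h => by
    obtain ⟨y, hy, hyx⟩ := hT1 h
    rw [Complex.ofReal_inj.1 hyx, mem_Ici] at hy
    have hpos : 0 < x := inv_pos.1 (one_pos.trans_le hy)
    exact hx' ⟨hpos.le, (one_le_inv₀ hpos).1 hy⟩
  obtain ⟨S, hS⟩ := notMem_opSpectrum_iff.1 hz
  have h := hR.isUnit_algebraMap_inv_sub (by simpa using hx0) hS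
  rw [spectrum.mem_iff] at hx
  refine hx ?_
  convert h using 2
  rw [← Complex.ofReal_inv, inv_inv]
  rfl

/-- The spectral theorem for self-adjoint operators with spectrum in `[1, ∞)`. -/
theorem exists_isSpectralFamilyOf (hT : IsSelfAdjoint T)
    (hT1 : opSpectrum T ⊆ Complex.ofReal '' Ici 1) :
    ∃ E : SpectralFamily H, E.IsSpectralFamilyOf T ∧ ∀ f, ∀ᵐ x ∂(E.meas f), 1 ≤ x := by
  have h0 : (0 : ℂ) ∉ opSpectrum T := fun h => by
    obtain ⟨y, hy, hy0⟩ := hT1 h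
    rw [Complex.ofReal_eq_zero.1 hy0, mem_Ici] at hy
    linarith
  obtain ⟨R, hR⟩ := notMem_opSpectrum_iff.1 h0
  have hRs := hR.isSelfAdjoint (isFormalAdjoint_of_isSelfAdjoint hT)
  have hspec := hR.spectrum_subset hT1
  have hinj : ∀ f, R f = 0 → f = 0 := fun f => hR.eq_zero_of_apply_eq_zero
  exact ⟨spectralFamilyInv hRs hspec hinj,
    (isResolvent_spectralFamilyInv hRs hspec hinj).operator_unique hR,
    one_le_ae_meas_spectralFamilyInv hRs hspec hinj⟩

/-- Uniqueness lets any known spectral family replace the chosen one in `opLog`, `opPow` and the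
scales. -/
lemma spectralFamily_eq {E : SpectralFamily H} (hE : E.IsSpectralFamilyOf T) :
    spectralFamily T = E := by
  have h : ∃ E : SpectralFamily H, E.IsSpectralFamilyOf T := ⟨E, hE⟩
  rw [spectralFamily, dif_pos h]
  exact SpectralFamily.eq_of_op_eq (h.choose_spec.trans hE.symm)

lemma existsUnique_isSpectralFamilyOf {E : SpectralFamily H} (hE : E.IsSpectralFamilyOf T) :
    ∃! E : SpectralFamily H, E.IsSpectralFamilyOf T :=
  ⟨E, hE, fun _ hF => SpectralFamily.eq_of_op_eq (hF.trans hE.symm)⟩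

end SelfAdjoint

/-! ### The logarithm of a spectral family -/

namespace SpectralFamily

variable (E : SpectralFamily H) (hE : ∀ f, ∀ᵐ x ∂(E.meas f), 1 ≤ x)

include hE

/-- Needed for `log`: since `exp t → 0` as `t → -∞`, the limit of `E(exp t)` is governed by `E` near
`0`. -/
lemma proj_eq_zero_of_lt_one {t : ℝ} (ht : t < 1) (f : H) : E.proj t f = 0 := by
  have h1 : (E.meas f).real (Iic t) = 0 := by
    rw [measureReal_eq_zero_iff]
    refine measure_mono_null (fun x hx => ?_) (ae_iff.1 (hE f))
    exact not_le.2 (lt_of_le_of_lt hx ht)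
  rw [meas_real_Iic, dist_eq_norm_sq] at h1
  simpa using h1

/-- The spectral family `t ↦ E(exp t)` of the logarithm. -/
def log : SpectralFamily H where
  proj t := E.proj (Real.exp t)
  isStarProjection t := E.isStarProjection _
  proj_comp s t hst := E.proj_comp _ _ (Real.exp_le_exp.2 hst)
  right_continuous f t := by
    refine ContinuousWithinAt.comp (t := Ici (Real.exp t)) (E.right_continuous f _)
      Real.continuous_exp.continuousWithinAt fun u hu => ?_
    exact Real.exp_le_exp.2 hu
  tendsto_atBot f := by
    refine tendsto_const_nhds.congr' ?_
    filter_upwards [Iio_mem_atBot (0 : ℝ)] with t ht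
    exact (E.proj_eq_zero_of_lt_one hE (by simpa using Real.exp_lt_exp.2 ht) f).symm
  tendsto_atTop f := (E.tendsto_atTop f).comp Real.tendsto_exp_atTop

lemma meas_log (f : H) : (E.log hE).meas f = (E.meas f).map Real.log := by
  refine Measure.ext_of_Iic _ _ fun t => ?_
  rw [Measure.map_apply Real.measurable_log measurableSet_Iic, meas_Iic]
  change ENNReal.ofReal (E.dist f (Real.exp t)) = _
  rw [← meas_Iic]
  refine measure_congr ?_
  filter_upwards [hE f] with x hx
  -- `log x ≤ t ↔ x ≤ exp t` requires `x > 0`; the remaining points, where `Real.log` takes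
  -- conventional values, are null.
  exact propext (Real.log_le_iff_le_exp (one_pos.trans_le hx)).symm

omit hE

variable {E} {F : SpectralFamily H} {θ φ : ℝ → ℝ}

lemma formDomain_of_meas_eq_map (h : ∀ f, F.meas f = (E.meas f).map θ) (hθ : Measurable θ)
    (hφ : Measurable φ) : F.formDomain φ = E.formDomain fun x => φ (θ x) := by
  ext f
  change Integrable φ (F.meas f) ↔ Integrable (fun x => φ (θ x)) (E.meas f)
  rw [h]
  exact integrable_map_measure hφ.aestronglyMeasurable hθ.aemeasurable

lemma opDomain_of_meas_eq_map (h : ∀ f, F.meas f = (E.meas f).map θ) (hθ : Measurable θ)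
    (hφ : Measurable φ) : F.opDomain φ = E.opDomain fun x => φ (θ x) := by
  ext f
  change MemLp φ 2 (F.meas f) ↔ MemLp (fun x => φ (θ x)) 2 (E.meas f)
  rw [h]
  exact memLp_map_measure_iff hφ.aestronglyMeasurable hθ.aemeasurable

lemma integral_of_meas_eq_map (h : ∀ f, F.meas f = (E.meas f).map θ) (hθ : Measurable θ)
    (hφ : Measurable φ) (g f : H) : F.integral φ g f = E.integral (fun x => φ (θ x)) g f := by
  simp only [integral, h, integral_map hθ.aemeasurable hφ.aestronglyMeasurable]

/-- For `θ = log` and `φ = id` this says that `E.log` is a spectral family of `∫ log t dE`. -/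
lemma op_of_meas_eq_map (h : ∀ f, F.meas f = (E.meas f).map θ) (hθ : Measurable θ)
    (hφ : Measurable φ) : F.op φ = E.op fun x => φ (θ x) := by
  simp only [op, opDomain_of_meas_eq_map h hθ hφ, integral_of_meas_eq_map h hθ hφ]

end SpectralFamily

/-! ### Scales of spaces -/

omit [CompleteSpace H] in
-- The type of the form depends on the space, so the spaces are identified before the forms are
-- compared.
lemma FormSubspace.ext_of_form {X Y : FormSubspace H} (hs : X.space = Y.space)
    (hf : ∀ g f (hg : g ∈ X.space) (hf : f ∈ X.space),
      X.form ⟨g, hg⟩ ⟨f, hf⟩ = Y.form ⟨g, hs ▸ hg⟩ ⟨f, hs ▸ hf⟩) : X = Y := by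
  obtain ⟨SX, FX⟩ := X
  obtain ⟨SY, FY⟩ := Y
  obtain rfl : SX = SY := hs
  congr 1
  exact LinearMap.ext fun g => LinearMap.ext fun f => hf g f g.2 f.2

/-- The graph norm of an operator with bounded inverse is complete. -/
lemma IsResolvent.exists_tendsto_of_cauchy {A : H →ₗ.[ℂ] H} {S : H →L[ℂ] H}
    (hS : IsResolvent A 0 S) (u : ℕ → A.domain)
    (hu : ∀ ε > 0, ∃ N, ∀ m ≥ N, ∀ n ≥ N, ‖A (u m - u n)‖ ^ 2 < ε) :
    ∃ f : A.domain, Tendsto (fun n => ‖A (u n - f)‖ ^ 2) atTop (𝓝 0) := by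
  have hc : CauchySeq fun n => A (u n) := by
    refine Metric.cauchySeq_iff.2 fun ε hε => ?_
    obtain ⟨N, hN⟩ := hu (ε ^ 2) (by positivity)
    refine ⟨N, fun m hm n hn => ?_⟩
    have := hN m hm n hn
    rw [LinearPMap.map_sub] at this
    rw [dist_eq_norm]
    exact lt_of_pow_lt_pow_left₀ 2 hε.le this
  obtain ⟨w, hw⟩ := cauchySeq_tendsto_of_complete hc
  obtain ⟨h, h'⟩ := hS.right_inv w
  rw [zero_smul, sub_zero] at h'
  -- The limit `w` of `A u_n` is attained, as `A S w = w`.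
  refine ⟨⟨S w, h⟩, ?_⟩
  have := ((hw.sub_const w).norm.pow 2)
  simpa [LinearPMap.map_sub, h'] using this

lemma ordinaryHilbertScale_form {T : H →ₗ.[ℂ] H} (s : ℝ≥0) (f : (opPow T (s / 2)).domain) :
    ((ordinaryHilbertScale T s).form f f).re = ‖opPow T (s / 2) f‖ ^ 2 := by
  have h : (ordinaryHilbertScale T s).form f f = ⟪opPow T (s / 2) f, opPow T (s / 2) f⟫_ℂ := rfl
  rw [h, inner_self_eq_norm_sq_to_K]
  norm_cast

/-- A bounded inverse makes `T^{s/2}` injective, hence the form definite, and surjective, hence the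
norm complete. -/
lemma ordinaryHilbertScale_isHilbert {T : H →ₗ.[ℂ] H} {s : ℝ≥0} {S : H →L[ℂ] H}
    (hS : IsResolvent (opPow T (s / 2)) 0 S) : (ordinaryHilbertScale T s).IsHilbert where
  conj_symm f g := inner_conj_symm _ _
  pos f hf := by
    refine lt_of_lt_of_eq (pow_pos (norm_pos_iff.2 fun h => hf ?_) 2)
      (ordinaryHilbertScale_form s f).symm
    have := hS.left_inv f
    rw [h, zero_smul, sub_zero, map_zero] at this
    exact Subtype.ext this.symm
  complete u hu := by
    obtain ⟨f, hf⟩ := hS.exists_tendsto_of_cauchy u fun ε hε => by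
      obtain ⟨N, hN⟩ := hu ε hε
      exact ⟨N, fun m hm n hn =>
        (ordinaryHilbertScale_form s (u m - u n)).symm.trans_lt (hN m hm n hn)⟩
    exact ⟨f, hf.congr fun n => (ordinaryHilbertScale_form s _).symm⟩

namespace SpectralFamily

variable {E : SpectralFamily H} {φ ψ : ℝ → ℝ}

lemma opDomain_eq_formDomain (hφ : Measurable φ) (h : ∀ f, (fun x => φ x ^ 2) =ᵐ[E.meas f] ψ) :
    E.opDomain φ = E.formDomain ψ := by
  ext f
  change MemLp φ 2 (E.meas f) ↔ Integrable ψ (E.meas f)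
  rw [memLp_two_iff_integrable_sq hφ.aestronglyMeasurable]
  exact integrable_congr (h f)

end SpectralFamily

lemma ordinaryHilbertScale_eq_dilationalHilbertScale {T : H →ₗ.[ℂ] H} {E : SpectralFamily H}
    (hE : E.IsSpectralFamilyOf T) (h1 : ∀ f, ∀ᵐ x ∂(E.meas f), 1 ≤ x)
    (hF : (E.log h1).IsSpectralFamilyOf (opLog T)) :
    ordinaryHilbertScale T = dilationalHilbertScale Real.exp (opLog T) := by
  funext s
  have hP : opPow T (s / 2) = E.op fun t => t ^ ((s : ℝ) / 2) := by
    rw [opPow, functionOf, spectralFamily_eq hE]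
  have hφ : Measurable fun t : ℝ => t ^ ((s : ℝ) / 2) := by fun_prop
  have hexp : Measurable fun t : ℝ => Real.exp (s * t) := by fun_prop
  have hm := E.meas_log h1
  have hlog := Real.measurable_log
  -- The pointwise identity behind the theorem, `(x^{s/2})² = exp(s log x)`, valid almost everywhere
  -- because the measures live on `[1, ∞)`.
  have hae : ∀ f, (fun x : ℝ => (x ^ ((s : ℝ) / 2)) ^ 2) =ᵐ[E.meas f]
      fun x => Real.exp (s * Real.log x) := fun f => by
    filter_upwards [h1 f] with x hx
    have hx0 : 0 < x := one_pos.trans_le hx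
    rw [Real.rpow_def_of_pos hx0, ← Real.exp_nat_mul]
    congr 1
    push_cast
    ring
  refine FormSubspace.ext_of_form ?_ fun g f hg hf => ?_
  · change (opPow T (s / 2)).domain =
      (spectralFamily (opLog T)).formDomain fun t => Real.exp (s * t)
    rw [spectralFamily_eq hF, SpectralFamily.formDomain_of_meas_eq_map hm hlog hexp, hP,
      SpectralFamily.op_domain E hφ, SpectralFamily.opDomain_eq_formDomain hφ hae]
  · change ⟪opPow T (s / 2) ⟨g, hg⟩, opPow T (s / 2) ⟨f, hf⟩⟫_ℂ =
      (spectralFamily (opLog T)).integral (fun t => Real.exp (s * t)) g f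
    change g ∈ (opPow T (s / 2)).domain at hg
    change f ∈ (opPow T (s / 2)).domain at hf
    rw [spectralFamily_eq hF, SpectralFamily.integral_of_meas_eq_map hm hlog hexp]
    -- The membership proofs depend on the operator, so they are generalized before it is rewritten.
    revert hg hf
    rw [hP]
    intro hg hf
    rw [E.inner_op_op hφ, E.integral_congr hae]

end HilbertScales

end

/-! ### The scales of `T` and of `log T` -/

theorem mainTheorem4 {H : Type*} [NormedAddCommGroup H] [InnerProductSpace ℂ H] [CompleteSpace H]
    (T : H →ₗ.[ℂ] H) (hT : IsSelfAdjoint T)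
    (hT1 : HilbertScales.opSpectrum T ⊆ Complex.ofReal '' Set.Ici 1) :
    (∃! E : HilbertScales.SpectralFamily H, E.IsSpectralFamilyOf T) ∧
    IsSelfAdjoint (HilbertScales.opLog T) ∧
    HilbertScales.opSpectrum (HilbertScales.opLog T) ⊆ Complex.ofReal '' Set.Ici 0 ∧
    (∃! F : HilbertScales.SpectralFamily H, F.IsSpectralFamilyOf (HilbertScales.opLog T)) ∧
    (∀ s : NNReal, (HilbertScales.ordinaryHilbertScale T s).IsHilbert) ∧
    HilbertScales.ordinaryHilbertScale T =
      HilbertScales.dilationalHilbertScale Real.exp (HilbertScales.opLog T) := by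
  obtain ⟨E, hE, h1⟩ := HilbertScales.exists_isSpectralFamilyOf hT hT1
  have hlog : HilbertScales.opLog T = E.op Real.log := by
    rw [HilbertScales.opLog, HilbertScales.functionOf, HilbertScales.spectralFamily_eq hE]
  have hF : (E.log h1).IsSpectralFamilyOf (HilbertScales.opLog T) := by
    rw [hlog]
    exact HilbertScales.SpectralFamily.op_of_meas_eq_map (E.meas_log h1) Real.measurable_log
      measurable_id
  refine ⟨HilbertScales.existsUnique_isSpectralFamilyOf hE, ?_, ?_,
    HilbertScales.existsUnique_isSpectralFamilyOf hF, fun s => ?_,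
    HilbertScales.ordinaryHilbertScale_eq_dilationalHilbertScale hE h1 hF⟩
  · rw [hlog]
    exact E.isSelfAdjoint_op Real.measurable_log
  · rw [hlog]
    refine E.opSpectrum_op_subset Real.measurable_log fun f => ?_
    filter_upwards [h1 f] with x hx
    exact Real.log_nonneg hx
  · have hP : HilbertScales.opPow T (s / 2) = E.op fun t => t ^ ((s : ℝ) / 2) := by
      rw [HilbertScales.opPow, HilbertScales.functionOf, HilbertScales.spectralFamily_eq hE]
    -- On `[1, ∞)` the function `t^{s/2}` is at least `1`, so `0` has distance at least `1` from its
    -- values.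
    have hR := E.isResolvent_op (φ := fun t => t ^ ((s : ℝ) / 2)) (z := 0) (by fun_prop) one_pos
      fun f => by
        filter_upwards [h1 f] with x hx
        rw [sub_zero, Complex.norm_real]
        exact (Real.one_le_rpow hx (by positivity)).trans (le_abs_self _)
    rw [← hP] at hR
    exact HilbertScales.ordinaryHilbertScale_isHilbert hR
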